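/- **Kernel limits at initialization.** Let $\phi:\mathbb R\to\mathbb R$ be continuously differentiable and Lipschitz, let $L\ge 0$, and let $n_0,\dots,n_{L+1}$ be the layer widths of a multilayer perceptron with pre-activations $$h^{(1)}(x)=\tfrac1{\sqrt{n_0}}W^{(1)}x+b^{(1)},\qquad h^{(l+1)}(x)=\tfrac1{\sqrt{n_l}}W^{(l+1)}\phi(h^{(l)}(x))+b^{(l+1)}\quad(1\le l\le L),$$ where $W^{(l)}\in\mathbb R^{n_l\times n_{l-1}}$, $b^{(l)}\in\mathbb R^{n_l}$, $\phi$ acts entrywise, and $f=h^{(L+1)}$ is the network. At initialization all entries of the $W^{(l)}$ and $b^{(l)}$ are independent, those of $W^{(l)}$ with law $\mathcal N(0,\sigma_W^2)$ and those of $b^{(l)}$ with law $\mathcal N(0,\sigma_b^2)$ ($\sigma_W,\sigma_b\ge0$). Let $\theta$ be the collection of all weights and biases, and define the empirical neural tangent kernel and the empirical adversarial regularization kernel of layer $l$ by $$\hat\Theta^{(l)}_\theta(x,x')=\partial_\theta h^{(l)}(x)\,\partial_\theta h^{(l)}(x')^T,\qquad \hat\Theta^{(l)}_x(x,x')=\partial_x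 h^{(l)}(x)\,\partial_x h^{(l)}(x')^T .$$ Let $\mathcal X$ be a family of inputs, each given by a vector in $\mathbb R^{n_0}$ for every input dimension $n_0$, such that $G(x,x'):=\lim_{n_0\to\infty}\frac1{n_0}x^Tx'$ exists for all $x,x'\in\mathcal X$. Define $$\Sigma^{(1)}=\sigma_W^2G+\sigma_b^2,\qquad \Sigma^{(l+1)}(x,x')=\sigma_W^2\,\mathbb E_{f\sim\mathcal{GP}(0,\Sigma^{(l)})}[\phi(f(x))\phi(f(x'))]+\sigma_b^2,$$ where $\mathcal{GP}(0,\Sigma)$ is the centered Gaussian process with covariance $\Sigma$. Then for all $x,x'\in\mathcal X$ and all $1\le l\le L+1$, with $n_l,\dots,n_{L+1}$ fixed, $$\lim_{n_{l-1}\to\infty}\cdots\lim_{n_0\to\infty}\hat\Theta^{(l)}_\theta(x,x')=\Theta^{\infty,(l)}_\theta(x,x')\,I_{n_l},\qquad \lim_{n_{l-1}\to\infty}\cdots\lim_{n_0\to\infty}\hat\Theta^{(l)}_x(x,x')=\Theta^{\infty,(l)}_x(x,x')\,I_{n_l},$$ where the deterministic kernels are given by $$\Theta^{\infty,(1)}_\theta=G+1,$$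 $$\Theta^{\infty,(l+1)}_\theta(x,x')=\sigma_W^2\,\Theta^{\infty,(l)}_\theta(x,x')\,\mathbb E_{f\sim\mathcal{GP}(0,\Sigma^{(l)})}[\phi'(f(x))\phi'(f(x'))]+\mathbb E_{f\sim\mathcal{GP}(0,\Sigma^{(l)})}[\phi(f(x))\phi(f(x'))]+1,$$ $$\Theta^{\infty,(1)}_x=\sigma_W^2,\qquad \Theta^{\infty,(l+1)}_x(x,x')=\sigma_W^2\,\Theta^{\infty,(l)}_x(x,x')\,\mathbb E_{f\sim\mathcal{GP}(0,\Sigma^{(l)})}[\phi'(f(x))\phi'(f(x'))].$$ Here the limits are taken one after another, first in $n_0$, and are limits in law: each successive weak limit of laws exists, and the last one is the point mass at the stated matrix (so the last convergence is in probability). -/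

import Mathlib

open MeasureTheory ProbabilityTheory Filter Topology
open scoped NNReal

noncomputable section

namespace WideMLP

/-- Names of the scalar parameters of a multilayer perceptron. Layers are counted from `0`:
layer `l` maps `n l` inputs to `n (l + 1)` outputs (so it is the layer usually numbered `l + 1`).
`weight l i j` is the entry `(i, j)` of the weight matrix of layer `l`, `bias l i` is the `i`-th
entry of its bias vector. A network with layer widths `n 0, n 1, …` uses only those parameters with
`i < n (l + 1)` and `j < n l`. -/
inductive ParamIdx : Type
  | weight (l i j : ℕ)
  | bias (l i : ℕ)
deriving DecidableEq

open ParamIdx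

/-- Pre-activation of neuron `i` of layer `l`:
`h⁰(x) = W⁰ x / √n₀ + b⁰` and `hˡ⁺¹(x) = Wˡ⁺¹ φ(hˡ(x)) / √nₗ₊₁ + bˡ⁺¹`.
The output of a network with `L` hidden layers is the pre-activation of layer `L`. -/
def preact (φ : ℝ → ℝ) (n : ℕ → ℕ) (θ : ParamIdx → ℝ) (x : Fin (n 0) → ℝ) : ℕ → ℕ → ℝ
  | 0, i => (1 / √(n 0 : ℝ)) * ∑ j : Fin (n 0), θ (weight 0 i j) * x j + θ (bias 0 i)
  | l + 1, i =>
      (1 / √(n (l + 1) : ℝ)) *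
          ∑ j : Fin (n (l + 1)), θ (weight (l + 1) i j) * φ (preact φ n θ x l j)
        + θ (bias (l + 1) i)

/-- Partial derivative of the pre-activation of neuron `i` of layer `l` with respect to the
parameter `p`. -/
def paramDeriv (φ : ℝ → ℝ) (n : ℕ → ℕ) (θ : ParamIdx → ℝ) (x : Fin (n 0) → ℝ)
    (l i : ℕ) (p : ParamIdx) : ℝ :=
  deriv (fun t => preact φ n (Function.update θ p t) x l i) (θ p)

/-- Partial derivative of the pre-activation of neuron `i` of layer `l` with respect to the
input coordinate `j`. -/
def inputDeriv (φ : ℝ → ℝ) (n : ℕ → ℕ) (θ : ParamIdx → ℝ) (x : Fin (n 0) → ℝ)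
    (l i : ℕ) (j : Fin (n 0)) : ℝ :=
  deriv (fun t => preact φ n θ (Function.update x j t) l i) (x j)

/-- Entry `(i, i')` of the empirical neural tangent kernel `∂_θ hˡ(x) · ∂_θ hˡ(x')ᵀ` of layer `l`,
for the network with layers `0, …, L` and widths `n 0, …, n (L + 1)`: the sum runs over all
weights and biases of that network. -/
def ntk (φ : ℝ → ℝ) (L : ℕ) (n : ℕ → ℕ) (θ : ParamIdx → ℝ) (x x' : Fin (n 0) → ℝ)
    (l i i' : ℕ) : ℝ :=
  ∑ k ∈ Finset.range (L + 1), ∑ r : Fin (n (k + 1)),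
    ((∑ s : Fin (n k),
        paramDeriv φ n θ x l i (weight k r s) * paramDeriv φ n θ x' l i' (weight k r s))
      + paramDeriv φ n θ x l i (bias k r) * paramDeriv φ n θ x' l i' (bias k r))

/-- Entry `(i, i')` of the empirical adversarial regularization kernel
`∂_x hˡ(x) · ∂_x hˡ(x')ᵀ` of layer `l`. -/
def ark (φ : ℝ → ℝ) (n : ℕ → ℕ) (θ : ParamIdx → ℝ) (x x' : Fin (n 0) → ℝ)
    (l i i' : ℕ) : ℝ :=
  ∑ j : Fin (n 0), inputDeriv φ n θ x l i j * inputDeriv φ n θ x' l i' j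

/-- Law of a parameter at initialization: weights are `N(0, σW²)`, biases are `N(0, σb²)`. -/
def initLaw (σW σb : ℝ≥0) : ParamIdx → Measure ℝ
  | weight _ _ _ => gaussianReal 0 (σW ^ 2)
  | bias _ _ => gaussianReal 0 (σb ^ 2)

variable {X : Type*}

/-- `E[g(f(u)) g(f(v))]` for a centered Gaussian process `f` with covariance function `S`, that is,
for a centered Gaussian pair `(f(u), f(v))` with the corresponding covariance matrix. -/
def gpExpect (S : X → X → ℝ) (g : ℝ → ℝ) (u v : X) : ℝ :=
  ∫ z : EuclideanSpace ℝ (Fin 2), g (z 0) * g (z 1)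
    ∂(multivariateGaussian 0 !![S u u, S u v; S v u, S v v])

/-- Covariance function of the limiting Gaussian process of layer `l`; `G u v` is the limit of
`xᵤᵀ xᵥ / n₀`. -/
def gpCov (φ : ℝ → ℝ) (σW σb : ℝ≥0) (G : X → X → ℝ) : ℕ → X → X → ℝ
  | 0, u, v => (σW : ℝ) ^ 2 * G u v + (σb : ℝ) ^ 2
  | l + 1, u, v =>
      (σW : ℝ) ^ 2 * gpExpect (gpCov φ σW σb G l) φ u v + (σb : ℝ) ^ 2

/-- The limiting neural tangent kernel of layer `l`. -/
def ntkLimit (φ : ℝ → ℝ) (σW σb : ℝ≥0) (G : X → X → ℝ) : ℕ → X → X → ℝ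
  | 0, u, v => G u v + 1
  | l + 1, u, v =>
      (σW : ℝ) ^ 2 * ntkLimit φ σW σb G l u v * gpExpect (gpCov φ σW σb G l) (deriv φ) u v
        + gpExpect (gpCov φ σW σb G l) φ u v + 1

/-- The limiting adversarial regularization kernel of layer `l`. -/
def arkLimit (φ : ℝ → ℝ) (σW σb : ℝ≥0) (G : X → X → ℝ) : ℕ → X → X → ℝ
  | 0, _, _ => (σW : ℝ) ^ 2
  | l + 1, u, v =>
      (σW : ℝ) ^ 2 * arkLimit φ σW σb G l u v * gpExpect (gpCov φ σW σb G l) (deriv φ) u v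

/-- Sequential limit in law: `lim_{n_{k-1} → ∞} ⋯ lim_{n_0 → ∞} F n = μ` (innermost limit first, over
`n 0`), where `F n` is the law of a random variable that depends on the widths `n`, every limit is
a weak limit of probability measures, and every inner limit is required to exist. The widths
`n k, n (k + 1), …` stay fixed. -/
def SeqLimLaw {M : Type*} [TopologicalSpace M] [MeasurableSpace M] [OpensMeasurableSpace M]
    (F : (ℕ → ℕ) → Measure M) : ℕ → (ℕ → ℕ) → ProbabilityMeasure M → Prop
  | 0, n, μ => F n = (μ : Measure M)
  | k + 1, n, μ => ∃ ν : ℕ → ProbabilityMeasure M,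
      (∀ m, 0 < m → SeqLimLaw F k (Function.update n k m) (ν m)) ∧ Tendsto ν atTop (𝓝 μ)

end WideMLP

end

noncomputable section

namespace WideMLP

open ParamIdx

/-! Both kernels obey one recursion. By the chain rule, the kernel of a layer is `(1/N) W D K D' Wᵀ
+ τ (A + 1) I`: here `K` is the kernel of the layer before, `D` and `D'` are the diagonal matrices
of `deriv φ` at the two inputs, and `A` is the averaged inner product of the incoming activations.
At the input layer `D` and `D'` are absent and `K = κ I`. The neural tangent kernel is `(κ, τ) = (0,
1)`: parameters of different layers do not interact, and those of the layer itself give the second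
term. The adversarial kernel is `(κ, τ) = (1, 0)`. So it suffices to follow a state: the
pre-activations for two inputs, and the kernel.

One width limit acts as follows. Let the incoming activations be deterministic with convergent Gram
averages, and the incoming kernel diagonal with bounded entries of convergent average. Then the
pre-activations of the next layer converge in law to independent Gaussian pairs (characteristic
functions), and its kernel converges in probability to a multiple of the identity (Chebyshev). By
Slutsky the state converges jointly: `tendsto_integral_affineState`.

The limit state again satisfies these assumptions almost surely: its Gaussian pairs are i.i.d., so
the strong law gives the averages, and its kernel stays diagonal under multiplication by `D` and
`D'`. Conditioning on the pairs, with the parameters of the next layers independent of them,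
dominated convergence yields the next limit (`tendsto_partialLimit`). The intermediate limit laws
are those of the remaining finite layers applied to a limit state; when no layer remains, the kernel
is deterministic and its law is a point mass. -/

/-- The pre-activations of the neurons of a layer for two inputs, together with a kernel indexed by
pairs of neurons of that layer. -/
abbrev LayerState : Type := (ℕ → EuclideanSpace ℝ (Fin 2)) × (ℕ → ℕ → ℝ)

/-- The affine map of layer `k` with `N` incoming activations `a j e` (`e` names the input), and the
kernel that it makes out of a kernel `K` of the incoming activations; `τ` is the weight of the
contribution of the parameters of the layer. -/
def affineState (k N : ℕ) (a : Fin N → Fin 2 → ℝ) (K : Fin N → Fin N → ℝ) (τ : ℝ)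
    (θ : ParamIdx → ℝ) : LayerState :=
  (fun i => WithLp.toLp 2 fun e =>
      (1 / √(N : ℝ)) * ∑ j : Fin N, θ (weight k i j) * a j e + θ (bias k i),
    fun i i' =>
      (1 / (N : ℝ)) * (∑ j : Fin N, ∑ j' : Fin N, θ (weight k i j) * θ (weight k i' j') * K j j')
        + (if i = i' then 1 else 0) * (τ * ((1 / (N : ℝ)) * (∑ j, a j 0 * a j 1) + 1)))

/-- The state of layer `k` as a function of the state of the layer before, of width `N`. -/
def layerMap (φ : ℝ → ℝ) (τ : ℝ) (k N : ℕ) (θ : ParamIdx → ℝ) (S : LayerState) : LayerState :=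
  affineState k N (fun j e => φ (S.1 j e))
    (fun j j' => deriv φ (S.1 j 0) * S.2 j j' * deriv φ (S.1 j' 1)) τ θ

/-- The state of each layer of the network. The kernel starts from `κ` times the identity. -/
def netState (φ : ℝ → ℝ) (κ τ : ℝ) (n : ℕ → ℕ) (x : Fin 2 → Fin (n 0) → ℝ) (θ : ParamIdx → ℝ) :
    ℕ → LayerState
  | 0 => affineState 0 (n 0) (fun j e => x e j) (fun j j' => if j = j' then κ else 0) τ θ
  | l + 1 => layerMap φ τ (l + 1) (n (l + 1)) θ (netState φ κ τ n x θ l)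

lemma netState_fst (φ : ℝ → ℝ) (κ τ : ℝ) (n : ℕ → ℕ) (x : Fin 2 → Fin (n 0) → ℝ)
    (θ : ParamIdx → ℝ) (l i : ℕ) (e : Fin 2) :
    (netState φ κ τ n x θ l).1 i e = preact φ n θ (x e) l i := by
  induction l generalizing i with
  | zero => simp [netState, affineState, preact]
  | succ l ih => simp [netState, layerMap, affineState, preact, ih]

/-! ### Parameter derivatives and the recursion for the neural tangent kernel -/

/-- Derivative of an affine combination of activations `y` in layer `k` with respect to the
parameters of that layer. -/
def directDeriv (k N : ℕ) (y : Fin N → ℝ) (i : ℕ) (p : ParamIdx) : ℝ :=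
  (1 / √(N : ℝ)) * ∑ j : Fin N, (if p = weight k i j then 1 else 0) * y j
    + if p = bias k i then 1 else 0

/-- The derivative of a pre-activation with respect to a parameter, by the chain rule. -/
def chainDeriv (φ : ℝ → ℝ) (n : ℕ → ℕ) (θ : ParamIdx → ℝ) (x : Fin (n 0) → ℝ) :
    ℕ → ℕ → ParamIdx → ℝ
  | 0, i, p => directDeriv 0 (n 0) x i p
  | l + 1, i, p =>
      directDeriv (l + 1) (n (l + 1)) (fun j => φ (preact φ n θ x l j)) i p
        + ∑ j : Fin (n (l + 1)), ((1 / √(n (l + 1) : ℝ)) * θ (weight (l + 1) i j)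
            * deriv φ (preact φ n θ x l j)) * chainDeriv φ n θ x l j p

lemma hasDerivAt_update (θ : ParamIdx → ℝ) (p q : ParamIdx) (t : ℝ) :
    HasDerivAt (fun t => Function.update θ p t q) (if p = q then 1 else 0) t := by
  by_cases h : p = q
  · subst h; simpa using hasDerivAt_id' t
  · simpa [Function.update_of_ne (Ne.symm h), h] using hasDerivAt_const t (θ q)

lemma hasDerivAt_preact {φ : ℝ → ℝ} (hφ : Differentiable ℝ φ) (n : ℕ → ℕ) (θ : ParamIdx → ℝ)
    (x : Fin (n 0) → ℝ) (l i : ℕ) (p : ParamIdx) :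
    HasDerivAt (fun t => preact φ n (Function.update θ p t) x l i)
      (chainDeriv φ n θ x l i p) (θ p) := by
  induction l generalizing i with
  | zero =>
    simp only [preact, chainDeriv, directDeriv]
    exact ((HasDerivAt.fun_sum (u := Finset.univ) fun (j : Fin (n 0)) _ =>
      (hasDerivAt_update θ p (weight 0 i j) (θ p)).mul_const (x j)).const_mul _).add
        (hasDerivAt_update θ p (bias 0 i) (θ p))
  | succ l ih =>
    simp only [preact]
    have key := ((HasDerivAt.fun_sum (u := Finset.univ) fun (j : Fin (n (l + 1))) _ =>
      (hasDerivAt_update θ p (weight (l + 1) i j) (θ p)).mul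
        ((hφ (preact φ n (Function.update θ p (θ p)) x l j)).hasDerivAt.comp (θ p)
          (ih j))).const_mul (1 / √(n (l + 1) : ℝ))).add
        (hasDerivAt_update θ p (bias (l + 1) i) (θ p))
    refine key.congr_deriv ?_
    simp only [chainDeriv, directDeriv, Function.update_eq_self, Function.comp_apply,
      Finset.sum_add_distrib, Finset.mul_sum, mul_add]
    rw [add_right_comm]
    congr 1
    exact congrArg _ (funext fun j => by ring)

lemma paramDeriv_eq {φ : ℝ → ℝ} (hφ : Differentiable ℝ φ) (n : ℕ → ℕ) (θ : ParamIdx → ℝ)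
    (x : Fin (n 0) → ℝ) (l i : ℕ) (p : ParamIdx) :
    paramDeriv φ n θ x l i p = chainDeriv φ n θ x l i p :=
  (hasDerivAt_preact hφ n θ x l i p).deriv

/-- The layer that a parameter belongs to. -/
def ParamIdx.layer : ParamIdx → ℕ
  | weight l _ _ => l
  | bias l _ => l

lemma directDeriv_eq_zero {k N : ℕ} {y : Fin N → ℝ} {i : ℕ} {p : ParamIdx}
    (hp : p.layer ≠ k) : directDeriv k N y i p = 0 := by
  have h1 : ∀ r s, p ≠ weight k r s := by rintro r s rfl; exact hp rfl
  have h2 : ∀ r, p ≠ bias k r := by rintro r rfl; exact hp rfl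
  simp [directDeriv, h1, h2]

lemma chainDeriv_eq_zero (φ : ℝ → ℝ) (n : ℕ → ℕ) (θ : ParamIdx → ℝ) (x : Fin (n 0) → ℝ)
    (l i : ℕ) (p : ParamIdx) (hp : l < p.layer) : chainDeriv φ n θ x l i p = 0 := by
  induction l generalizing i with
  | zero => exact directDeriv_eq_zero hp.ne'
  | succ l ih =>
    simp [chainDeriv, directDeriv_eq_zero hp.ne', ih _ (Nat.lt_of_succ_lt hp)]

/-- Inner product of two functions on the parameters of layers `0, …, L` of a network. -/
def paramInner (L : ℕ) (n : ℕ → ℕ) (f g : ParamIdx → ℝ) : ℝ :=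
  ∑ k ∈ Finset.range (L + 1), ∑ r : Fin (n (k + 1)),
    ((∑ s : Fin (n k), f (weight k r s) * g (weight k r s)) + f (bias k r) * g (bias k r))

lemma paramInner_congr {L : ℕ} {n : ℕ → ℕ} {f g f' g' : ParamIdx → ℝ}
    (h : ∀ p, f p * g p = f' p * g' p) : paramInner L n f g = paramInner L n f' g' := by
  simp only [paramInner, h]

/-- The hypothesis concerns only pointwise products, so it covers bilinearity as well as a splitting
in which the cross terms vanish. -/
lemma paramInner_add_of_mul_eq {L : ℕ} {n : ℕ → ℕ} {f g f₁ g₁ f₂ g₂ : ParamIdx → ℝ}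
    (h : ∀ p, f p * g p = f₁ p * g₁ p + f₂ p * g₂ p) :
    paramInner L n f g = paramInner L n f₁ g₁ + paramInner L n f₂ g₂ := by
  simp only [paramInner, h, ← Finset.sum_add_distrib]
  refine Finset.sum_congr rfl fun k _ => Finset.sum_congr rfl fun r _ => ?_
  rw [Finset.sum_add_distrib]
  ring

lemma paramInner_zero_left {L : ℕ} {n : ℕ → ℕ} (g : ParamIdx → ℝ) :
    paramInner L n (fun _ => 0) g = 0 := by
  simp [paramInner]

lemma paramInner_sum_left {L : ℕ} {n : ℕ → ℕ} {ι : Type*} (s : Finset ι) (c : ι → ℝ)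
    (f : ι → ParamIdx → ℝ) (g : ParamIdx → ℝ) :
    paramInner L n (fun p => ∑ j ∈ s, c j * f j p) g = ∑ j ∈ s, c j * paramInner L n (f j) g := by
  classical
  induction s using Finset.induction_on with
  | empty => simpa using paramInner_zero_left g
  | insert a s ha ih =>
    rw [Finset.sum_insert ha, ← ih,
      paramInner_add_of_mul_eq (f₁ := f a) (g₁ := fun p => c a * g p)
        (f₂ := fun p => ∑ j ∈ s, c j * f j p) (g₂ := g)
        (fun p => by rw [Finset.sum_insert ha]; ring)]
    congr 1
    simp only [paramInner, Finset.mul_sum, mul_add]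
    refine Finset.sum_congr rfl fun k _ => Finset.sum_congr rfl fun r _ => ?_
    congr 1
    · exact Finset.sum_congr rfl fun s _ => by ring
    · ring

lemma paramInner_comm {L : ℕ} {n : ℕ → ℕ} (f g : ParamIdx → ℝ) :
    paramInner L n f g = paramInner L n g f :=
  paramInner_congr fun _ => mul_comm _ _

/-- Only the parameters feeding neuron `i` contribute, so `i` alone has to be a neuron of the
network: `i'` matters only through equality with `i`. -/
lemma paramInner_directDeriv {L k : ℕ} {n : ℕ → ℕ} (hk : k ≤ L) (y y' : Fin (n k) → ℝ)
    {i : ℕ} (hi : i < n (k + 1)) (i' : ℕ) :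
    paramInner L n (directDeriv k (n k) y i) (directDeriv k (n k) y' i')
      = if i = i' then (1 / (n k : ℝ)) * (∑ j, y j * y' j) + 1 else 0 := by
  have hsq : (1 / √(n k : ℝ)) * (1 / √(n k : ℝ)) = 1 / (n k : ℝ) := by
    rw [div_mul_div_comm, one_mul, Real.mul_self_sqrt (Nat.cast_nonneg _)]
  rw [paramInner, Finset.sum_eq_single k]
  · rw [Finset.sum_eq_single (⟨i, hi⟩ : Fin (n (k + 1)))]
    · split_ifs with h
      · subst h
        simp only [directDeriv, weight.injEq, true_and, Fin.val_inj, reduceCtorEq, if_false,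
          ite_mul, one_mul, zero_mul, Finset.sum_ite_eq, Finset.mem_univ, if_true, add_zero,
          Finset.sum_const_zero, mul_zero, mul_one, zero_add]
        rw [← hsq, Finset.mul_sum]
        congr 1
        exact Finset.sum_congr rfl fun j _ => by ring
      · simp [directDeriv, h]
    · intro r _ hr
      have : (r : ℕ) ≠ i := fun h => hr (Fin.ext h)
      simp [directDeriv, this]
    · simp
  · intro k' _ hk'
    refine Finset.sum_eq_zero fun r _ => ?_
    rw [directDeriv_eq_zero (p := bias k' r) hk',
      Finset.sum_eq_zero fun s _ => by rw [directDeriv_eq_zero (p := weight k' r s) hk', zero_mul]]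
    simp
  · intro h
    exact absurd (Finset.mem_range.2 (Nat.lt_succ_of_le hk)) h

lemma ntk_eq_paramInner {φ : ℝ → ℝ} (hφ : Differentiable ℝ φ) (L : ℕ) (n : ℕ → ℕ)
    (θ : ParamIdx → ℝ) (x x' : Fin (n 0) → ℝ) (l i i' : ℕ) :
    ntk φ L n θ x x' l i i'
      = paramInner L n (chainDeriv φ n θ x l i) (chainDeriv φ n θ x' l i') := by
  simp only [ntk, paramInner, paramDeriv_eq hφ]

theorem ntk_eq_netState {φ : ℝ → ℝ} (hφ : Differentiable ℝ φ) (L : ℕ) (n : ℕ → ℕ)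
    (θ : ParamIdx → ℝ) (x : Fin 2 → Fin (n 0) → ℝ) {l i : ℕ} (hl : l ≤ L) (hi : i < n (l + 1))
    {i' : ℕ} (hi' : i' < n (l + 1)) :
    ntk φ L n θ (x 0) (x 1) l i i' = (netState φ 0 1 n x θ l).2 i i' := by
  rw [ntk_eq_paramInner hφ]
  induction l generalizing i i' with
  | zero =>
    change paramInner L n (directDeriv 0 (n 0) (x 0) i) (directDeriv 0 (n 0) (x 1) i') = _
    rw [paramInner_directDeriv hl _ _ hi]
    simp [netState, affineState]
  | succ l ih =>
    have hsq : (1 / √(n (l + 1) : ℝ)) * (1 / √(n (l + 1) : ℝ)) = 1 / (n (l + 1) : ℝ) := by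
      rw [div_mul_div_comm, one_mul, Real.mul_self_sqrt (Nat.cast_nonneg _)]
    rw [paramInner_add_of_mul_eq
      (f₁ := directDeriv (l + 1) (n (l + 1)) (fun j => φ (preact φ n θ (x 0) l j)) i)
      (g₁ := directDeriv (l + 1) (n (l + 1)) (fun j => φ (preact φ n θ (x 1) l j)) i')
      (f₂ := fun p => ∑ j : Fin (n (l + 1)), ((1 / √(n (l + 1) : ℝ)) * θ (weight (l + 1) i j)
            * deriv φ (preact φ n θ (x 0) l j)) * chainDeriv φ n θ (x 0) l j p)
      (g₂ := fun p => ∑ j : Fin (n (l + 1)), ((1 / √(n (l + 1) : ℝ)) * θ (weight (l + 1) i' j)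
            * deriv φ (preact φ n θ (x 1) l j)) * chainDeriv φ n θ (x 1) l j p)]
    · rw [paramInner_directDeriv hl _ _ hi, paramInner_sum_left]
      simp only [netState, layerMap, affineState, netState_fst, one_mul]
      rw [add_comm]
      congr 1
      swap
      · rw [ite_mul, one_mul, zero_mul]
      rw [Finset.mul_sum]
      refine Finset.sum_congr rfl fun j _ => ?_
      rw [paramInner_comm, paramInner_sum_left, Finset.mul_sum, Finset.mul_sum]
      refine Finset.sum_congr rfl fun j' _ => ?_
      rw [paramInner_comm, ih (Nat.le_of_succ_le hl) j.2 j'.2, ← hsq]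
      ring
    · intro p
      simp only [chainDeriv]
      -- No cross terms: in layer `l + 1` the chained part vanishes, and in every other layer the
      -- direct part does.
      by_cases hp : p.layer = l + 1
      · have h0 : ∀ e j, chainDeriv φ n θ (x e) l j p = 0 := fun e j =>
          chainDeriv_eq_zero φ n θ (x e) l j p (by omega)
        simp [h0]
      · simp [directDeriv_eq_zero hp]

/-! ### Input derivatives and the recursion for the adversarial kernel -/

/-- The derivative of a pre-activation with respect to an input coordinate, by the chain rule. -/
def chainInputDeriv (φ : ℝ → ℝ) (n : ℕ → ℕ) (θ : ParamIdx → ℝ) (x : Fin (n 0) → ℝ)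
    (q : Fin (n 0)) : ℕ → ℕ → ℝ
  | 0, i => (1 / √(n 0 : ℝ)) * θ (weight 0 i q)
  | l + 1, i => ∑ j : Fin (n (l + 1)), ((1 / √(n (l + 1) : ℝ)) * θ (weight (l + 1) i j)
            * deriv φ (preact φ n θ x l j)) * chainInputDeriv φ n θ x q l j

lemma hasDerivAt_preact_input {φ : ℝ → ℝ} (hφ : Differentiable ℝ φ) (n : ℕ → ℕ)
    (θ : ParamIdx → ℝ) (x : Fin (n 0) → ℝ) (l i : ℕ) (q : Fin (n 0)) :
    HasDerivAt (fun t => preact φ n θ (Function.update x q t) l i)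
      (chainInputDeriv φ n θ x q l i) (x q) := by
  induction l generalizing i with
  | zero =>
    simp only [preact, chainInputDeriv]
    have h : ∀ j : Fin (n 0), HasDerivAt (fun t => Function.update x q t j)
        (if j = q then 1 else 0) (x q) := by
      intro j
      by_cases h : j = q
      · subst h; simpa using hasDerivAt_id' (x j)
      · simpa [Function.update_of_ne h, h] using hasDerivAt_const (x q) (x j)
    refine (((HasDerivAt.fun_sum (u := Finset.univ) fun j _ =>
      (h j).const_mul (θ (weight 0 i j))).const_mul (1 / √(n 0 : ℝ))).add_const _).congr_deriv ?_
    simp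
  | succ l ih =>
    simp only [preact]
    have key := ((HasDerivAt.fun_sum (u := Finset.univ) fun (j : Fin (n (l + 1))) _ =>
        (((hφ (preact φ n θ (Function.update x q (x q)) l j)).hasDerivAt.comp (x q)
          (ih j))).const_mul (θ (weight (l + 1) i j))).const_mul
            (1 / √(n (l + 1) : ℝ))).add_const (θ (bias (l + 1) i))
    refine key.congr_deriv ?_
    simp only [chainInputDeriv, Function.update_eq_self, Finset.mul_sum]
    exact Finset.sum_congr rfl fun j _ => by ring

theorem ark_eq_netState {φ : ℝ → ℝ} (hφ : Differentiable ℝ φ) (n : ℕ → ℕ)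
    (θ : ParamIdx → ℝ) (x : Fin 2 → Fin (n 0) → ℝ) (l i i' : ℕ) :
    ark φ n θ (x 0) (x 1) l i i' = (netState φ 1 0 n x θ l).2 i i' := by
  have hd : ∀ e l i q, inputDeriv φ n θ (x e) l i q = chainInputDeriv φ n θ (x e) q l i :=
    fun e l i q => (hasDerivAt_preact_input hφ n θ (x e) l i q).deriv
  have hsq : ∀ N : ℕ, (1 / √(N : ℝ)) * (1 / √(N : ℝ)) = 1 / (N : ℝ) := fun N => by
    rw [div_mul_div_comm, one_mul, Real.mul_self_sqrt (Nat.cast_nonneg _)]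
  simp only [ark, hd]
  induction l generalizing i i' with
  | zero =>
    simp only [chainInputDeriv, netState, affineState, ← hsq, zero_mul, add_zero,
      mul_ite, mul_one, mul_zero, Finset.sum_ite_eq, Finset.mem_univ, if_true, Finset.mul_sum]
    exact Finset.sum_congr rfl fun j _ => by ring
  | succ l ih =>
    simp only [chainInputDeriv, netState, layerMap, affineState, netState_fst, zero_mul, mul_zero,
      add_zero, ← ih, ← hsq, Finset.sum_mul_sum]
    simp only [Finset.mul_sum, Finset.sum_mul]
    rw [Finset.sum_comm]
    refine Finset.sum_congr rfl fun j _ => ?_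
    rw [Finset.sum_comm]
    exact Finset.sum_congr rfl fun j' _ => Finset.sum_congr rfl fun q _ => by ring

/-! ### Convergence in measure and the weak law -/

/-- A union bound over the finitely many coordinates. -/
lemma tendstoInMeasure_of_forall_apply {α ι κ E : Type*} [Fintype ι] [SeminormedAddCommGroup E]
    {m : MeasurableSpace α} {μ : Measure α} {l : Filter κ} {f : κ → α → ι → E} {g : α → ι → E}
    (h : ∀ i, TendstoInMeasure μ (fun k a => f k a i) l (fun a => g a i)) :
    TendstoInMeasure μ f l g := by
  simp only [tendstoInMeasure_iff_norm] at h ⊢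
  intro ε hε
  have hsum : Tendsto (fun k => ∑ i, μ {x | ε ≤ ‖f k x i - g x i‖}) l (𝓝 0) := by
    simpa using tendsto_finsetSum Finset.univ fun i _ => h i ε hε
  refine tendsto_of_tendsto_of_tendsto_of_le_of_le tendsto_const_nhds hsum (fun _ => zero_le)
    fun k => ?_
  refine (measure_mono fun x hx => ?_).trans
    (measure_iUnion_fintype_le μ fun i => {x | ε ≤ ‖f k x i - g x i‖})
  by_contra hcon
  simp only [Set.mem_iUnion, Set.mem_ofPred_eq, not_exists, not_le] at hcon
  exact absurd ((pi_norm_lt_iff hε).2 hcon) (not_lt.2 hx)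

/-- Weak law of large numbers for averages with bounded deterministic weights. -/
lemma tendstoInMeasure_weighted_average {Ω : Type*} {mΩ : MeasurableSpace Ω} {P : Measure Ω}
    [IsProbabilityMeasure P] {X : ℕ → Ω → ℝ} (hX : ∀ j, MemLp (X j) 2 P)
    (hind : Pairwise fun j j' => IndepFun (X j) (X j') P) {m V : ℝ} (hm : ∀ j, ∫ ω, X j ω ∂P = m)
    (hV : ∀ j, Var[X j; P] ≤ V) {p : (N : ℕ) → Fin N → ℝ} {K : ℝ} (hK : ∀ N j, |p N j| ≤ K)
    {π : ℝ} (hp : Tendsto (fun N : ℕ => (1 / (N : ℝ)) * ∑ j : Fin N, p N j) atTop (𝓝 π))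
    {d : ℕ → ℝ} {δ : ℝ} (hd : Tendsto d atTop (𝓝 δ)) :
    TendstoInMeasure P (fun (N : ℕ) ω => (1 / (N : ℝ)) * ∑ j : Fin N, X j ω * p N j + d N) atTop
      (fun _ => m * π + δ) := by
  have hmem : ∀ N (j : Fin N), MemLp (fun ω => (1 / (N : ℝ)) * p N j * X j ω) 2 P := fun N j =>
    (hX j).const_mul _
  have hS : ∀ N : ℕ, (fun ω => (1 / (N : ℝ)) * ∑ j : Fin N, X j ω * p N j)
      = ∑ j : Fin N, fun ω => (1 / (N : ℝ)) * p N j * X j ω := fun N => by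
    ext ω
    rw [Finset.sum_apply, Finset.mul_sum]
    exact Finset.sum_congr rfl fun j _ => by ring
  have hmemS : ∀ N : ℕ, MemLp (fun ω => (1 / (N : ℝ)) * ∑ j : Fin N, X j ω * p N j) 2 P :=
    fun N => by rw [hS]; exact memLp_finsetSum' _ fun j _ => hmem N j
  have hmean : ∀ N : ℕ, ∫ ω, (1 / (N : ℝ)) * ∑ j : Fin N, X j ω * p N j ∂P
      = m * ((1 / (N : ℝ)) * ∑ j, p N j) := fun N => by
    rw [integral_const_mul, integral_finsetSum]
    · simp only [integral_mul_const, hm, ← Finset.mul_sum]; ring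
    · exact fun j _ => ((hX j).integrable one_le_two).mul_const _
  have hK0 : ∀ N (j : Fin N), p N j ^ 2 ≤ K ^ 2 := fun N j => by
    rw [← sq_abs]; exact pow_le_pow_left₀ (abs_nonneg _) (hK N j) 2
  have hV0 : 0 ≤ V := (variance_nonneg _ _).trans (hV 0)
  have hvar : ∀ N : ℕ, Var[fun ω => (1 / (N : ℝ)) * ∑ j : Fin N, X j ω * p N j; P]
      ≤ K ^ 2 * V * (1 / (N : ℝ)) := fun N => by
    rw [hS, IndepFun.variance_sum (fun j _ => hmem N j)]
    · calc ∑ j : Fin N, Var[fun ω => (1 / (N : ℝ)) * p N j * X j ω; P]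
          ≤ ∑ j : Fin N, (1 / (N : ℝ)) ^ 2 * (K ^ 2 * V) := by
            refine Finset.sum_le_sum fun j _ => ?_
            rw [variance_const_mul, mul_pow, mul_assoc]
            exact mul_le_mul_of_nonneg_left
              (mul_le_mul (hK0 N j) (hV j) (variance_nonneg _ _) (sq_nonneg _)) (sq_nonneg _)
        _ = K ^ 2 * V * (1 / (N : ℝ)) := by
            rcases Nat.eq_zero_or_pos N with rfl | hN
            · simp
            · have : (N : ℝ) ≠ 0 := by positivity
              simp only [Finset.sum_const, Finset.card_univ, Fintype.card_fin, nsmul_eq_mul]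
              field_simp
    · intro j _ j' _ hjj'
      have := hind (Fin.val_injective.ne hjj')
      exact this.comp (φ := fun x => (1 / (N : ℝ)) * p N j * x)
        (ψ := fun x => (1 / (N : ℝ)) * p N j' * x) (by fun_prop) (by fun_prop)
  -- Half of `ε` is for the deterministic error of the mean, eventually smaller than that; the other
  -- half is for the fluctuation, by Chebyshev and the `O(1/N)` variance.
  rw [tendstoInMeasure_iff_norm]
  intro ε hε
  have hbound : Tendsto (fun N : ℕ => ENNReal.ofReal (K ^ 2 * V * (1 / (N : ℝ)) / (ε / 2) ^ 2))
      atTop (𝓝 0) := by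
    have h1 : Tendsto (fun N : ℕ => K ^ 2 * V * (1 / (N : ℝ)) / (ε / 2) ^ 2) atTop (𝓝 0) := by
      simpa using (tendsto_one_div_atTop_nhds_zero_nat (𝕜 := ℝ)).const_mul (K ^ 2 * V)
        |>.div_const ((ε / 2) ^ 2)
    simpa using ENNReal.tendsto_ofReal h1
  have hclose : ∀ᶠ N : ℕ in atTop, |m * ((1 / (N : ℝ)) * ∑ j, p N j) + d N - (m * π + δ)|
      < ε / 2 := by
    have := Metric.tendsto_nhds.1 ((hp.const_mul m).add hd) (ε / 2) (half_pos hε)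
    simpa [Real.dist_eq] using this
  refine tendsto_of_tendsto_of_tendsto_of_le_of_le' tendsto_const_nhds hbound
    (.of_forall fun _ => zero_le) ?_
  filter_upwards [hclose] with N hN
  refine (measure_mono fun ω hω => ?_).trans
    ((meas_ge_le_variance_div_sq (hmemS N) (half_pos hε)).trans
      (ENNReal.ofReal_le_ofReal (div_le_div_of_nonneg_right (hvar N) (by positivity))))
  simp only [Set.mem_ofPred_eq, Real.norm_eq_abs] at hω ⊢
  rw [hmean]
  have := abs_sub_le ((1 / (N : ℝ)) * ∑ j : Fin N, X j ω * p N j + d N)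
    (m * ((1 / (N : ℝ)) * ∑ j, p N j) + d N) (m * π + δ)
  rw [add_sub_add_right_eq_sub] at this
  linarith

/-! ### Gaussian parameters: moments and characteristic functions -/

/-- The variance of a parameter at initialization. -/
def initVar (σW σb : ℝ≥0) : ParamIdx → ℝ≥0
  | weight _ _ _ => σW ^ 2
  | bias _ _ => σb ^ 2

lemma initLaw_eq (σW σb : ℝ≥0) (p : ParamIdx) :
    initLaw σW σb p = gaussianReal 0 (initVar σW σb p) := by
  cases p <;> rfl

instance (σW σb : ℝ≥0) (p : ParamIdx) : IsProbabilityMeasure (initLaw σW σb p) := by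
  rw [initLaw_eq]; infer_instance

/-- The law of the parameters at initialization. -/
abbrev initMeasure (σW σb : ℝ≥0) : Measure (ParamIdx → ℝ) := Measure.infinitePi (initLaw σW σb)

lemma iIndepFun_eval_initMeasure (σW σb : ℝ≥0) :
    iIndepFun (fun (p : ParamIdx) (θ : ParamIdx → ℝ) => θ p) (initMeasure σW σb) :=
  iIndepFun_infinitePi (X := fun _ x => x) fun _ => measurable_id

lemma map_eval_initMeasure (σW σb : ℝ≥0) (p : ParamIdx) :
    (initMeasure σW σb).map (fun θ => θ p) = gaussianReal 0 (initVar σW σb p) := by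
  rw [Measure.infinitePi_map_eval, initLaw_eq]

lemma memLp_eval_initMeasure (σW σb : ℝ≥0) (p : ParamIdx) {q : ENNReal} (hq : q ≠ ⊤) :
    MemLp (fun θ : ParamIdx → ℝ => θ p) q (initMeasure σW σb) := by
  have h := memLp_id_gaussianReal' (μ := 0) (v := initVar σW σb p) q hq
  rw [← map_eval_initMeasure, memLp_map_measure_iff (f := fun θ : ParamIdx → ℝ => θ p)
    (by fun_prop) (measurable_pi_apply p).aemeasurable] at h
  exact h

lemma integral_eval_initMeasure (σW σb : ℝ≥0) (p : ParamIdx) :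
    ∫ θ, θ p ∂(initMeasure σW σb) = 0 := by
  have h := integral_id_gaussianReal (μ := 0) (v := initVar σW σb p)
  rwa [← map_eval_initMeasure, integral_map (measurable_pi_apply p).aemeasurable (by fun_prop)] at h

lemma integral_sq_eval_initMeasure (σW σb : ℝ≥0) (p : ParamIdx) :
    ∫ θ, θ p * θ p ∂(initMeasure σW σb) = initVar σW σb p := by
  have h := variance_id_gaussianReal (μ := 0) (v := initVar σW σb p)
  rw [variance_of_integral_eq_zero (by fun_prop) (by simp),
    ← map_eval_initMeasure, integral_map (measurable_pi_apply p).aemeasurable (by fun_prop)] at h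
  simpa [sq] using h

/-- Independence factors the characteristic function. The value at `1` suffices, since the
characteristic function of a vector at `t` is that of its inner product with `t` at `1`. -/
lemma charFun_map_sum_initMeasure (σW σb : ℝ≥0) {ι : Type*} [Fintype ι] {f : ι → ParamIdx}
    (hf : Function.Injective f) (c : ι → ℝ) :
    charFun ((initMeasure σW σb).map fun θ => ∑ q, c q * θ (f q)) 1
      = Complex.exp (-((∑ q, initVar σW σb (f q) * c q ^ 2 : ℝ) : ℂ) / 2) := by
  have hind : iIndepFun (fun q (θ : ParamIdx → ℝ) => c q * θ (f q)) (initMeasure σW σb) :=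
    ((iIndepFun_eval_initMeasure σW σb).precomp hf).comp (fun q x => c q * x) fun q => by fun_prop
  rw [hind.charFun_map_fun_sum_eq_prod fun q =>
    (measurable_const.mul (measurable_pi_apply (f q))).aemeasurable, Finset.prod_apply]
  have hq : ∀ q, charFun ((initMeasure σW σb).map fun θ => c q * θ (f q)) 1
      = Complex.exp (-((initVar σW σb (f q) * c q ^ 2 : ℝ) : ℂ) / 2) := fun q => by
    have : (fun θ : ParamIdx → ℝ => c q * θ (f q)) = (fun x => c q * x) ∘ fun θ => θ (f q) := rfl
    rw [this, ← Measure.map_map (by fun_prop) (by fun_prop), map_eval_initMeasure, charFun_map_mul,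
      charFun_gaussianReal]
    congr 1
    push_cast
    ring
  simp only [hq, ← Complex.exp_sum]
  congr 1
  push_cast
  rw [← Finset.sum_div, Finset.sum_neg_distrib]

lemma integral_mul_eval_initMeasure (σW σb : ℝ≥0) {p q : ParamIdx} (hpq : p ≠ q) :
    ∫ θ, θ p * θ q ∂(initMeasure σW σb) = 0 := by
  rw [((iIndepFun_eval_initMeasure σW σb).indepFun hpq).integral_fun_mul_eq_mul_integral
    (memLp_eval_initMeasure σW σb p ENNReal.one_ne_top).1
    (memLp_eval_initMeasure σW σb q ENNReal.one_ne_top).1, integral_eval_initMeasure, zero_mul]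

lemma integral_pow_four_eval_initMeasure (σW σb : ℝ≥0) (p : ParamIdx) :
    ∫ θ, θ p ^ 4 ∂(initMeasure σW σb) = ∫ x, x ^ 4 ∂(gaussianReal 0 (initVar σW σb p)) := by
  rw [← map_eval_initMeasure, integral_map (measurable_pi_apply p).aemeasurable (by fun_prop)]

lemma memLp_mul_eval_initMeasure (σW σb : ℝ≥0) (p q : ParamIdx) :
    MemLp (fun θ : ParamIdx → ℝ => θ p * θ q) 2 (initMeasure σW σb) := by
  have : ENNReal.HolderTriple 4 4 2 := ⟨by
    rw [← two_mul, show (4 : ENNReal) = 2 * 2 by norm_num,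
      ENNReal.mul_inv (by simp) (by simp), ← mul_assoc,
      ENNReal.mul_inv_cancel (by simp) (by simp), one_mul]⟩
  exact (memLp_eval_initMeasure σW σb q (q := 4) (by simp)).mul
    (memLp_eval_initMeasure σW σb p (q := 4) (by simp))

/-- From `a² b² ≤ (a⁴ + b⁴) / 2`, a bound that treats `i = i'` and `i ≠ i'` alike and does not
depend on `j`. -/
lemma variance_mul_weight_le (σW σb : ℝ≥0) (k i i' j : ℕ) :
    Var[fun θ : ParamIdx → ℝ => θ (weight k i j) * θ (weight k i' j); initMeasure σW σb]
      ≤ ∫ x, x ^ 4 ∂(gaussianReal 0 (σW ^ 2)) := by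
  have hint : ∀ p : ParamIdx, Integrable (fun θ : ParamIdx → ℝ => θ p ^ 4) (initMeasure σW σb) :=
    fun p => by
      have := (memLp_eval_initMeasure σW σb p (q := (4 : ℕ)) (by simp)).integrable_norm_pow
        (by simp)
      simpa [Even.pow_abs (show Even 4 by decide)] using this
  refine (variance_le_expectation_sq (memLp_mul_eval_initMeasure σW σb _ _).1).trans ?_
  have h4 : ∀ i, ∫ θ, θ (weight k i j) ^ 4 ∂(initMeasure σW σb)
      = ∫ x, x ^ 4 ∂(gaussianReal 0 (σW ^ 2)) := fun i =>
    integral_pow_four_eval_initMeasure σW σb _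
  calc _ ≤ ∫ θ, ((1 / 2) * θ (weight k i j) ^ 4 + (1 / 2) * θ (weight k i' j) ^ 4)
        ∂(initMeasure σW σb) := by
        refine integral_mono (memLp_mul_eval_initMeasure σW σb _ _).integrable_sq
          (((hint _).const_mul _).add ((hint _).const_mul _)) fun θ => ?_
        simp only [Pi.pow_apply]
        nlinarith [sq_nonneg (θ (weight k i j) ^ 2 - θ (weight k i' j) ^ 2)]
    _ = _ := by
        rw [integral_add ((hint _).const_mul _) ((hint _).const_mul _), integral_const_mul,
          integral_const_mul, h4, h4]
        ring

/-- For a diagonal incoming kernel the double sum collapses to an average of `W i j * W i' j * p j`.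
The weight products are pairwise independent in `j`, with mean `σW²` if `i = i'` and `0` otherwise,
so the weighted weak law applies. -/
lemma tendstoInMeasure_affineState_snd (σW σb : ℝ≥0) (k : ℕ) {a : (N : ℕ) → Fin N → Fin 2 → ℝ}
    {c : ℝ} (ha : Tendsto (fun N : ℕ => (1 / (N : ℝ)) * ∑ j : Fin N, a N j 0 * a N j 1) atTop (𝓝 c))
    {p : (N : ℕ) → Fin N → ℝ} {K : ℝ} (hK : ∀ N j, |p N j| ≤ K) {π : ℝ}
    (hp : Tendsto (fun N : ℕ => (1 / (N : ℝ)) * ∑ j : Fin N, p N j) atTop (𝓝 π)) (τ : ℝ)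
    (i i' : ℕ) :
    TendstoInMeasure (initMeasure σW σb)
      (fun N θ => (affineState k N (a N) (fun j j' => if j = j' then p N j else 0) τ θ).2 i i')
      atTop (fun _ => (if i = i' then 1 else 0) * ((σW : ℝ) ^ 2 * π + τ * (c + 1))) := by
  have hmean : ∀ j : ℕ, ∫ θ, θ (weight k i j) * θ (weight k i' j) ∂(initMeasure σW σb)
      = (if i = i' then 1 else 0) * (σW : ℝ) ^ 2 := fun j => by
    split_ifs with h
    · subst h
      simp [integral_sq_eval_initMeasure, initVar]
    · rw [integral_mul_eval_initMeasure σW σb (by simpa using h), zero_mul]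
  have hind : Pairwise fun j j' => IndepFun
      (fun θ : ParamIdx → ℝ => θ (weight k i j) * θ (weight k i' j))
      (fun θ : ParamIdx → ℝ => θ (weight k i j') * θ (weight k i' j')) (initMeasure σW σb) := by
    intro j j' hjj'
    exact ((iIndepFun_eval_initMeasure σW σb).indepFun_prodMk_prodMk measurable_pi_apply
      (weight k i j) (weight k i' j) (weight k i j') (weight k i' j') (by simp [hjj'])
      (by simp [hjj']) (by simp [hjj']) (by simp [hjj'])).comp
        (φ := fun x : ℝ × ℝ => x.1 * x.2) (ψ := fun x : ℝ × ℝ => x.1 * x.2)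
        (by fun_prop) (by fun_prop)
  have h := tendstoInMeasure_weighted_average
    (fun j => memLp_mul_eval_initMeasure σW σb (weight k i j) (weight k i' j)) hind hmean
    (variance_mul_weight_le σW σb k i i') hK hp
    ((((ha.add_const 1).const_mul τ)).const_mul (if i = i' then 1 else 0))
  refine (h.congr_left fun N => .of_forall fun θ => ?_).congr_right (.of_forall fun _ => ?_)
  · simp [affineState]
  · ring

/-! ### The limit of one layer with deterministic incoming activations -/

/-- Covariance of the pre-activations of a neuron when the Gram matrix of the incoming
activations is `C`. -/
def layerCov (σW σb : ℝ≥0) (C : Fin 2 → Fin 2 → ℝ) : Matrix (Fin 2) (Fin 2) ℝ :=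
  Matrix.of fun e e' => (σW : ℝ) ^ 2 * C e e' + (σb : ℝ) ^ 2

lemma dotProduct_layerCov (σW σb : ℝ≥0) (C : Fin 2 → Fin 2 → ℝ) (t : Fin 2 → ℝ) :
    t ⬝ᵥ (layerCov σW σb C).mulVec t
      = (σW : ℝ) ^ 2 * (∑ e, ∑ e', t e * t e' * C e e') + (σb : ℝ) ^ 2 * (∑ e, t e) ^ 2 := by
  simp only [dotProduct, Matrix.mulVec, layerCov, Matrix.of_apply, Fin.sum_univ_two]
  ring

section Gram

variable {a : (N : ℕ) → Fin N → Fin 2 → ℝ} {C : Fin 2 → Fin 2 → ℝ}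

lemma tendsto_gram_quadratic
    (ha : ∀ e e', Tendsto (fun N : ℕ => (1 / (N : ℝ)) * ∑ j : Fin N, a N j e * a N j e') atTop
      (𝓝 (C e e'))) (t : Fin 2 → ℝ) :
    Tendsto (fun N : ℕ => (1 / (N : ℝ)) * ∑ j : Fin N, (∑ e, t e * a N j e) ^ 2) atTop
      (𝓝 (∑ e, ∑ e', t e * t e' * C e e')) := by
  have h := tendsto_finsetSum Finset.univ fun e _ =>
    tendsto_finsetSum Finset.univ fun e' _ => (ha e e').const_mul (t e * t e')
  refine h.congr fun N => ?_
  simp only [Fin.sum_univ_two, Finset.mul_sum, ← Finset.sum_add_distrib]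
  exact Finset.sum_congr rfl fun j _ => by ring

/-- A limit of Gram matrices is positive semidefinite. Without this the formula for the Gaussian
characteristic function is not available. -/
lemma posSemidef_layerCov
    (ha : ∀ e e', Tendsto (fun N : ℕ => (1 / (N : ℝ)) * ∑ j : Fin N, a N j e * a N j e') atTop
      (𝓝 (C e e'))) (σW σb : ℝ≥0) : (layerCov σW σb C).PosSemidef := by
  rw [Matrix.posSemidef_iff_dotProduct_mulVec]
  refine ⟨?_, fun t => ?_⟩
  · ext e e'
    have : C e' e = C e e' := tendsto_nhds_unique (ha e' e)
      ((ha e e').congr fun N => by simp only [mul_comm])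
    simp [layerCov, this]
  · rw [star_trivial, dotProduct_layerCov]
    have : 0 ≤ ∑ e, ∑ e', t e * t e' * C e e' :=
      ge_of_tendsto' (tendsto_gram_quadratic ha t) fun N =>
        mul_nonneg (by positivity) (Finset.sum_nonneg fun j _ => sq_nonneg _)
    positivity

/-- The pre-activations of the first `M` neurons, as a vector of a Euclidean space. -/
def preactVec (M : ℕ) (S : LayerState) : PiLp 2 fun _ : Fin M => EuclideanSpace ℝ (Fin 2) :=
  WithLp.toLp 2 fun i => S.1 i

lemma measurable_affineState_fst (k N : ℕ) (a : Fin N → Fin 2 → ℝ) (K : Fin N → Fin N → ℝ)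
    (τ : ℝ) (M : ℕ) : Measurable fun θ => preactVec M (affineState k N a K τ θ) := by
  unfold preactVec affineState
  fun_prop

lemma charFun_preactVec (σW σb : ℝ≥0) (k N : ℕ) (a : Fin N → Fin 2 → ℝ) (K : Fin N → Fin N → ℝ)
    (τ : ℝ) (M : ℕ) (t : PiLp 2 fun _ : Fin M => EuclideanSpace ℝ (Fin 2)) :
    charFun ((initMeasure σW σb).map fun θ => preactVec M (affineState k N a K τ θ)) t
      = Complex.exp (-((∑ i, ((σW : ℝ) ^ 2 * ((1 / (N : ℝ)) * ∑ j, (∑ e, t i e * a j e) ^ 2)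
          + (σb : ℝ) ^ 2 * (∑ e, t i e) ^ 2) : ℝ) : ℂ) / 2) := by
  -- The inner product with `t` is a linear combination of distinct parameters: the weights into,
  -- and the biases of, the first `M` neurons.
  let f : (Fin M × Fin N) ⊕ Fin M → ParamIdx :=
    Sum.elim (fun q => weight k q.1 q.2) (fun i => bias k i)
  have hf : Function.Injective f := by
    rintro (⟨i, j⟩ | i) (⟨i', j'⟩ | i') h <;> simp_all [f, Fin.ext_iff]
  let c : (Fin M × Fin N) ⊕ Fin M → ℝ :=
    Sum.elim (fun q => (1 / √(N : ℝ)) * ∑ e, t q.1 e * a q.2 e) (fun i => ∑ e, t i e)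
  have hinner : ∀ θ, inner ℝ (preactVec M (affineState k N a K τ θ)) t = ∑ q, c q * θ (f q) := by
    intro θ
    simp only [PiLp.inner_apply, preactVec, affineState, Fintype.sum_sum_type, c, f, Sum.elim_inl,
      Sum.elim_inr, Fintype.sum_prod_type, Fin.sum_univ_two, RCLike.inner_apply, conj_trivial,
      ← Finset.sum_add_distrib]
    refine Finset.sum_congr rfl fun i _ => ?_
    rw [mul_add, mul_add, Finset.mul_sum, Finset.mul_sum, Finset.mul_sum, Finset.mul_sum]
    rw [add_add_add_comm, ← Finset.sum_add_distrib, add_mul]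
    congr 1
    exact Finset.sum_congr rfl fun j _ => by ring
  have h := charFun_map_sum_initMeasure σW σb hf c
  have hmeas : Measurable fun θ : ParamIdx → ℝ => ∑ q, c q * θ (f q) := by fun_prop
  rw [charFun_apply_real, integral_map hmeas.aemeasurable (by fun_prop)] at h
  rw [charFun_apply, integral_map (measurable_affineState_fst k N a K τ M).aemeasurable
    (by fun_prop)]
  simp only [hinner]
  simp only [Complex.ofReal_one, one_mul] at h
  rw [h]
  congr 4
  have hsq : (1 / √(N : ℝ)) ^ 2 = 1 / (N : ℝ) := by
    rw [div_pow, one_pow, Real.sq_sqrt (Nat.cast_nonneg _)]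
  simp only [Fintype.sum_sum_type, c, f, Sum.elim_inl, Sum.elim_inr, Fintype.sum_prod_type,
    ← Finset.sum_add_distrib, initVar, NNReal.coe_pow, mul_pow, hsq]
  simp only [Finset.sum_add_distrib, ← Finset.mul_sum]

/-- Lévy continuity: the exponent is a quadratic form in the Gram averages and a sum over neurons,
so the limit is Gaussian with independent neurons. -/
lemma tendstoInDistribution_preactVec
    (ha : ∀ e e', Tendsto (fun N : ℕ => (1 / (N : ℝ)) * ∑ j : Fin N, a N j e * a N j e') atTop
      (𝓝 (C e e'))) (σW σb : ℝ≥0) (k : ℕ) (K : (N : ℕ) → Fin N → Fin N → ℝ) (τ : ℝ) (M : ℕ) :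
    TendstoInDistribution (fun N θ => preactVec M (affineState k N (a N) (K N) τ θ)) atTop
      (fun H : ℕ → EuclideanSpace ℝ (Fin 2) => preactVec M (H, 0)) (fun _ => initMeasure σW σb)
      (Measure.infinitePi fun _ : ℕ => multivariateGaussian 0 (layerCov σW σb C)) := by
  have hZ : Measurable fun H : ℕ → EuclideanSpace ℝ (Fin 2) => preactVec M (H, 0) := by
    unfold preactVec; fun_prop
  refine ⟨fun N => (measurable_affineState_fst k N _ _ τ M).aemeasurable, hZ.aemeasurable, ?_⟩
  refine ProbabilityMeasure.tendsto_iff_tendsto_charFun.2 fun t => ?_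
  simp only [ProbabilityMeasure.coe_mk, charFun_preactVec]
  have hmap : (Measure.infinitePi fun _ : ℕ => multivariateGaussian 0 (layerCov σW σb C)).map
      (fun H => preactVec M (H, 0))
      = (Measure.pi fun _ : Fin M => multivariateGaussian 0 (layerCov σW σb C)).map
          (WithLp.toLp 2) := by
    rw [← Measure.infinitePi_eq_pi, ← Measure.map_infinitePi_infinitePi_of_inj
      (P := fun _ : ℕ => multivariateGaussian 0 (layerCov σW σb C)) Fin.val_injective,
      Measure.map_map (by fun_prop) (by fun_prop)]
    rfl
  rw [hmap, charFun_pi]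
  simp only [charFun_multivariateGaussian (posSemidef_layerCov ha σW σb), inner_zero_right,
    Complex.ofReal_zero, zero_mul, zero_sub, ← Complex.exp_sum]
  have hlim : Tendsto (fun N : ℕ => ∑ i, ((σW : ℝ) ^ 2 * ((1 / (N : ℝ)) *
      ∑ j, (∑ e, t i e * a N j e) ^ 2) + (σb : ℝ) ^ 2 * (∑ e, t i e) ^ 2)) atTop
      (𝓝 (∑ i, (t i).ofLp ⬝ᵥ (layerCov σW σb C).mulVec (t i).ofLp)) := by
    simp only [dotProduct_layerCov]
    exact tendsto_finsetSum _ fun i _ =>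
      ((tendsto_gram_quadratic ha (t i)).const_mul _).add_const _
  have h := (Complex.continuous_exp.tendsto _).comp
    (((Complex.continuous_ofReal.tendsto _).comp hlim).neg.div_const 2)
  convert h using 2
  congr 1
  push_cast
  rw [Finset.sum_neg_distrib, ← Finset.sum_div, neg_div]

/-- The state of the first `M` neurons. -/
def restrictState (M : ℕ) (S : LayerState) :
    (Fin M → EuclideanSpace ℝ (Fin 2)) × (Fin M → Fin M → ℝ) :=
  (fun i => S.1 i, fun i i' => S.2 i i')

/-- The state with pre-activations `H` whose kernel is `c` times the identity. -/
def diagState (c : ℝ) (H : ℕ → EuclideanSpace ℝ (Fin 2)) : LayerState :=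
  (H, fun i i' => (if i = i' then 1 else 0) * c)

theorem tendsto_integral_affineState
    (ha : ∀ e e', Tendsto (fun N : ℕ => (1 / (N : ℝ)) * ∑ j : Fin N, a N j e * a N j e') atTop
      (𝓝 (C e e'))) (σW σb : ℝ≥0) (k : ℕ)
    {p : (N : ℕ) → Fin N → ℝ} {K : ℝ} (hK : ∀ N j, |p N j| ≤ K) {π : ℝ}
    (hp : Tendsto (fun N : ℕ => (1 / (N : ℝ)) * ∑ j : Fin N, p N j) atTop (𝓝 π)) (τ : ℝ) (M : ℕ)
    {g : (Fin M → EuclideanSpace ℝ (Fin 2)) × (Fin M → Fin M → ℝ) → ℝ} (hg : Continuous g)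
    {B : ℝ} (hB : ∀ S, |g S| ≤ B) :
    Tendsto (fun N : ℕ => ∫ θ, g (restrictState M
        (affineState k N (a N) (fun j j' => if j = j' then p N j else 0) τ θ))
        ∂(initMeasure σW σb)) atTop
      (𝓝 (∫ H, g (restrictState M (diagState ((σW : ℝ) ^ 2 * π + τ * (C 0 1 + 1)) H))
        ∂(Measure.infinitePi fun _ : ℕ => multivariateGaussian 0 (layerCov σW σb C)))) := by
  have hX := tendstoInDistribution_preactVec ha σW σb k
    (fun N j j' => if j = j' then p N j else 0) τ M
  have hY : TendstoInMeasure (initMeasure σW σb) (fun N θ (i i' : Fin M) =>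
      (affineState k N (a N) (fun j j' => if j = j' then p N j else 0) τ θ).2 i i') atTop
      (fun _ i i' => (if (i : ℕ) = i' then 1 else 0) * ((σW : ℝ) ^ 2 * π + τ * (C 0 1 + 1))) :=
    tendstoInMeasure_of_forall_apply fun i => tendstoInMeasure_of_forall_apply fun i' =>
      tendstoInMeasure_affineState_snd σW σb k (ha 0 1) hK hp τ i i'
  have hYm : ∀ N, AEMeasurable (fun (θ : ParamIdx → ℝ) (i i' : Fin M) =>
      (affineState k N (a N) (fun j j' => if j = j' then p N j else 0) τ θ).2 i i')
      (initMeasure σW σb) := fun N => by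
    refine Measurable.aemeasurable ?_
    unfold affineState
    fun_prop
  have h := hX.continuous_comp_prodMk_of_tendstoInMeasure_const
    (g := fun S : (PiLp 2 fun _ : Fin M => EuclideanSpace ℝ (Fin 2)) × (Fin M → Fin M → ℝ) =>
      g (S.1.ofLp, S.2)) (by fun_prop) hY hYm
  -- Slutsky gives convergence in law of the real variable `g`; testing against a clipping at `±B`
  -- leaves `g` unchanged and gives its expectation.
  have h' := (ProbabilityMeasure.tendsto_iff_forall_integral_tendsto.1 h.tendsto)
    (BoundedContinuousFunction.ofNormedAddCommGroup (fun x : ℝ => max (-B) (min B x))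
      (by fun_prop) |B| fun x => by
        rw [Real.norm_eq_abs, abs_le]
        constructor
        · exact (neg_le_neg (le_abs_self B)).trans (le_max_left _ _)
        · exact max_le (neg_le_abs B) ((min_le_left _ _).trans (le_abs_self B)))
  have hclip : ∀ S, max (-B) (min B (g S)) = g S := fun S => by
    rw [min_eq_right (abs_le.1 (hB S)).2, max_eq_right (abs_le.1 (hB S)).1]
  simp only [ProbabilityMeasure.coe_mk, BoundedContinuousFunction.coe_ofNormedAddCommGroup] at h'
  rw [integral_map h.aemeasurable_limit (by fun_prop)] at h'
  simp only [hclip] at h'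
  refine h'.congr fun N => ?_
  rw [integral_map (h.forall_aemeasurable N) (by fun_prop)]
  simp only [hclip]
  rfl

end Gram

/-! ### The remaining layers of a network -/

/-- The state `d` layers after layer `k`, as a function of the state of layer `k`. -/
def tailState (φ : ℝ → ℝ) (τ : ℝ) (n : ℕ → ℕ) (θ : ParamIdx → ℝ) :
    ℕ → ℕ → LayerState → LayerState
  | 0, _, S => S
  | d + 1, k, S => tailState φ τ n θ d (k + 1) (layerMap φ τ (k + 1) (n (k + 1)) θ S)

lemma tailState_netState (φ : ℝ → ℝ) (κ τ : ℝ) (n : ℕ → ℕ) (x : Fin 2 → Fin (n 0) → ℝ)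
    (θ : ParamIdx → ℝ) (d k : ℕ) :
    tailState φ τ n θ d k (netState φ κ τ n x θ k) = netState φ κ τ n x θ (k + d) := by
  induction d generalizing k with
  | zero => rfl
  | succ d ih => exact (ih (k + 1)).trans (by rw [Nat.succ_add_eq_add_succ])

lemma tailState_congr_width (φ : ℝ → ℝ) (τ : ℝ) {n n' : ℕ → ℕ} (θ : ParamIdx → ℝ) (d : ℕ) {k : ℕ}
    (h : ∀ i, k < i → n i = n' i) : tailState φ τ n θ d k = tailState φ τ n' θ d k := by
  induction d generalizing k with
  | zero => rfl
  | succ d ih =>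
    funext S
    simp only [tailState, h (k + 1) (Nat.lt_succ_self k), ih fun i hi => h i (Nat.lt_of_succ_lt hi)]

lemma layerMap_congr_param (φ : ℝ → ℝ) (τ : ℝ) {k : ℕ} (N : ℕ) {θ θ' : ParamIdx → ℝ}
    (h : ∀ p : ParamIdx, p.layer = k → θ p = θ' p) :
    layerMap φ τ k N θ = layerMap φ τ k N θ' := by
  funext S
  have hw : ∀ i j, θ (weight k i j) = θ' (weight k i j) := fun i j => h _ rfl
  have hb : ∀ i, θ (bias k i) = θ' (bias k i) := fun i => h _ rfl
  simp only [layerMap, affineState, hw, hb]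

lemma tailState_congr_param (φ : ℝ → ℝ) (τ : ℝ) (n : ℕ → ℕ) {θ θ' : ParamIdx → ℝ} (d : ℕ) {k : ℕ}
    (h : ∀ p : ParamIdx, k < p.layer → θ p = θ' p) :
    tailState φ τ n θ d k = tailState φ τ n θ' d k := by
  induction d generalizing k with
  | zero => rfl
  | succ d ih =>
    funext S
    rw [tailState, tailState, ih fun p hp => h p (Nat.lt_of_succ_lt hp),
      layerMap_congr_param φ τ _ fun p hp => h p (hp ▸ Nat.lt_succ_self k)]

/-- The first remaining layer reads only `n (k + 1)` neurons; if no layer remains, the claim is the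
hypothesis. -/
lemma restrictState_tailState (φ : ℝ → ℝ) (τ : ℝ) (n : ℕ → ℕ) (θ : ParamIdx → ℝ) (d k : ℕ)
    {S S' : LayerState} (h : restrictState (n (k + 1)) S = restrictState (n (k + 1)) S') :
    restrictState (n (k + d + 1)) (tailState φ τ n θ d k S)
      = restrictState (n (k + d + 1)) (tailState φ τ n θ d k S') := by
  cases d with
  | zero => exact h
  | succ d =>
    have h1 : ∀ j : Fin (n (k + 1)), S.1 j = S'.1 j := fun j => congrFun (congrArg Prod.fst h) j
    have h2 : ∀ j j' : Fin (n (k + 1)), S.2 j j' = S'.2 j j' := fun j j' =>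
      congrFun (congrFun (congrArg Prod.snd h) j) j'
    simp only [tailState, layerMap, h1, h2]

/-- Continuity of `deriv φ` enters here: weak limits must pass through the remaining layers. -/
lemma continuous_layerMap {φ : ℝ → ℝ} (hφ : ContDiff ℝ 1 φ) (τ : ℝ) (k N : ℕ)
    (θ : ParamIdx → ℝ) :
    Continuous (layerMap φ τ k N θ) := by
  have h1 := hφ.continuous
  have h2 := hφ.continuous_deriv le_rfl
  unfold layerMap affineState
  fun_prop

lemma measurable_layerMap {φ : ℝ → ℝ} (hφ : ContDiff ℝ 1 φ) (τ : ℝ) (k N : ℕ) :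
    Measurable fun z : (ParamIdx → ℝ) × LayerState => layerMap φ τ k N z.1 z.2 := by
  have h1 := hφ.continuous.measurable
  have h2 := (hφ.continuous_deriv le_rfl).measurable
  unfold layerMap affineState
  fun_prop

lemma continuous_tailState {φ : ℝ → ℝ} (hφ : ContDiff ℝ 1 φ) (τ : ℝ)
    (n : ℕ → ℕ) (θ : ParamIdx → ℝ) (d k : ℕ) :
    Continuous (tailState φ τ n θ d k) := by
  induction d generalizing k with
  | zero => exact continuous_id
  | succ d ih => exact (ih (k + 1)).comp (continuous_layerMap hφ τ _ _ θ)

lemma measurable_tailState {φ : ℝ → ℝ} (hφ : ContDiff ℝ 1 φ) (τ : ℝ)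
    (n : ℕ → ℕ) (d k : ℕ) :
    Measurable fun z : (ParamIdx → ℝ) × LayerState => tailState φ τ n z.1 d k z.2 := by
  induction d generalizing k with
  | zero => exact measurable_snd
  | succ d ih =>
    exact (ih (k + 1)).comp (measurable_fst.prodMk (measurable_layerMap hφ τ _ _))

/-! ### Resampling the parameters of later layers -/

/-- The parameters `θ` up to layer `k` and `θ'` after it. -/
def mixParams (k : ℕ) (θ θ' : ParamIdx → ℝ) : ParamIdx → ℝ :=
  fun p => if p.layer ≤ k then θ p else θ' p

lemma measurable_mixParams (k : ℕ) :
    Measurable fun z : (ParamIdx → ℝ) × (ParamIdx → ℝ) => mixParams k z.2 z.1 := by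
  refine measurable_pi_lambda _ fun p => ?_
  unfold mixParams
  split_ifs <;> fun_prop

/-- On boxes the product measure splits over two complementary sets of coordinates. Thus the
parameters after layer `k` can be replaced by an independent copy, and Fubini conditions on them. -/
lemma map_mixParams (σW σb : ℝ≥0) (k : ℕ) :
    ((initMeasure σW σb).prod (initMeasure σW σb)).map (fun z => mixParams k z.2 z.1)
      = initMeasure σW σb := by
  refine Measure.eq_infinitePi _ fun s t ht => ?_
  have hpre : (fun z : (ParamIdx → ℝ) × (ParamIdx → ℝ) => mixParams k z.2 z.1) ⁻¹'
      (Set.pi s t) = (Set.pi (s.filter fun p => ¬ p.layer ≤ k) t) ×ˢ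
        (Set.pi (s.filter fun p => p.layer ≤ k) t) := by
    ext z
    simp only [Set.mem_preimage, Set.mem_pi, Set.mem_prod, mixParams, Finset.coe_filter,
      Finset.mem_coe, Set.mem_ofPred_eq]
    constructor
    · intro h
      refine ⟨fun p hp => ?_, fun p hp => ?_⟩
      · simpa [hp.2] using h p hp.1
      · simpa [hp.2] using h p hp.1
    · intro h p hp
      split_ifs with hk
      · exact h.2 p ⟨hp, hk⟩
      · exact h.1 p ⟨hp, hk⟩
  rw [Measure.map_apply (measurable_mixParams k)
    (MeasurableSet.pi s.countable_toSet fun p _ => ht p), hpre, Measure.prod_prod,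
    Measure.infinitePi_pi _ fun p _ => ht p, Measure.infinitePi_pi _ fun p _ => ht p, mul_comm,
    Finset.prod_filter_mul_prod_filter_not]

lemma affineState_mixParams (k N : ℕ) (a : Fin N → Fin 2 → ℝ) (K : Fin N → Fin N → ℝ) (τ : ℝ)
    (θ θ' : ParamIdx → ℝ) :
    affineState k N a K τ (mixParams k θ θ') = affineState k N a K τ θ := by
  simp [affineState, mixParams, ParamIdx.layer]

lemma measurable_affineState (k N : ℕ) (a : Fin N → Fin 2 → ℝ) (K : Fin N → Fin N → ℝ)
    (τ : ℝ) : Measurable (affineState k N a K τ) := by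
  unfold affineState
  fun_prop

lemma measurable_diagState (c : ℝ) : Measurable (diagState c) := by
  unfold diagState
  fun_prop

/-- The state that vanishes outside the first `M` neurons. -/
def extendState (M : ℕ) (S : (Fin M → EuclideanSpace ℝ (Fin 2)) × (Fin M → Fin M → ℝ)) :
    LayerState :=
  (fun i => if h : i < M then S.1 ⟨i, h⟩ else 0,
    fun i i' => if h : i < M ∧ i' < M then S.2 ⟨i, h.1⟩ ⟨i', h.2⟩ else 0)

lemma continuous_extendState (M : ℕ) : Continuous (extendState M) := by
  refine Continuous.prodMk (continuous_pi fun i => ?_)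
    (continuous_pi fun i => continuous_pi fun i' => ?_)
  · split_ifs <;> fun_prop
  · split_ifs <;> fun_prop

lemma restrictState_extendState (M : ℕ)
    (S : (Fin M → EuclideanSpace ℝ (Fin 2)) × (Fin M → Fin M → ℝ)) :
    restrictState M (extendState M S) = S := by
  simp [restrictState, extendState]

/-- `Ψ` sees only parameters after layer `k`, the state only those of layer `k`. After resampling,
the parameters in `Ψ` are frozen, the one-layer limit applies to the inner integral, and dominated
convergence to the outer one. -/
theorem tendsto_integral_comp_affineState {a : (N : ℕ) → Fin N → Fin 2 → ℝ}
    {C : Fin 2 → Fin 2 → ℝ}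
    (ha : ∀ e e', Tendsto (fun N : ℕ => (1 / (N : ℝ)) * ∑ j : Fin N, a N j e * a N j e') atTop
      (𝓝 (C e e'))) (σW σb : ℝ≥0) (k : ℕ)
    {p : (N : ℕ) → Fin N → ℝ} {K : ℝ} (hK : ∀ N j, |p N j| ≤ K) {π : ℝ}
    (hp : Tendsto (fun N : ℕ => (1 / (N : ℝ)) * ∑ j : Fin N, p N j) atTop (𝓝 π)) (τ : ℝ) (M : ℕ)
    {Ψ : (ParamIdx → ℝ) → LayerState → ℝ} (hmeas : Measurable fun z : _ × _ => Ψ z.1 z.2)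
    (hcont : ∀ θ, Continuous (Ψ θ)) {B : ℝ} (hB : ∀ θ S, |Ψ θ S| ≤ B)
    (hparam : ∀ θ θ', (∀ p : ParamIdx, k < p.layer → θ p = θ' p) → Ψ θ = Ψ θ')
    (hrestrict : ∀ θ S S', restrictState M S = restrictState M S' → Ψ θ S = Ψ θ S') :
    Tendsto (fun N : ℕ => ∫ θ, Ψ θ
        (affineState k N (a N) (fun j j' => if j = j' then p N j else 0) τ θ)
        ∂(initMeasure σW σb)) atTop
      (𝓝 (∫ θ, ∫ H, Ψ θ (diagState ((σW : ℝ) ^ 2 * π + τ * (C 0 1 + 1)) H)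
        ∂(Measure.infinitePi fun _ : ℕ => multivariateGaussian 0 (layerCov σW σb C))
        ∂(initMeasure σW σb))) := by
  have hresample : ∀ N : ℕ, ∫ θ, Ψ θ
        (affineState k N (a N) (fun j j' => if j = j' then p N j else 0) τ θ) ∂(initMeasure σW σb)
      = ∫ θ', ∫ θ, Ψ θ' (affineState k N (a N) (fun j j' => if j = j' then p N j else 0) τ θ)
        ∂(initMeasure σW σb) ∂(initMeasure σW σb) := fun N => by
    have hm : Measurable fun θ => Ψ θ
        (affineState k N (a N) (fun j j' => if j = j' then p N j else 0) τ θ) :=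
      hmeas.comp (measurable_id.prodMk (measurable_affineState k N _ _ τ))
    have hm2 := hm.comp (measurable_mixParams k)
    conv_lhs => rw [← map_mixParams σW σb k]
    rw [integral_map (measurable_mixParams k).aemeasurable hm.aestronglyMeasurable, integral_prod]
    · refine integral_congr_ae (.of_forall fun θ' => integral_congr_ae (.of_forall fun θ => ?_))
      simp only [affineState_mixParams]
      rw [hparam (mixParams k θ θ') θ' fun p hp => by simp [mixParams, not_le.2 hp]]
    · exact Integrable.of_bound hm2.aestronglyMeasurable B (.of_forall fun z => hB _ _)
  simp only [hresample]
  refine tendsto_integral_of_dominated_convergence (fun _ => B) (fun N => ?_)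
    (integrable_const _) (fun N => .of_forall fun θ' => ?_) (.of_forall fun θ' => ?_)
  · refine (StronglyMeasurable.integral_prod_right'
      (f := fun z : (ParamIdx → ℝ) × (ParamIdx → ℝ) => Ψ z.1
        (affineState k N (a N) (fun j j' => if j = j' then p N j else 0) τ z.2))
      ?_).aestronglyMeasurable
    exact (hmeas.comp (measurable_fst.prodMk
      ((measurable_affineState k N _ _ τ).comp measurable_snd))).stronglyMeasurable
  · refine (norm_integral_le_of_norm_le_const (.of_forall fun θ => hB _ _)).trans ?_
    simp
  -- Extension by zero factors the test function continuously through the finitely many neurons on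
  -- which it depends.
  · have hfac : ∀ S, Ψ θ' S = Ψ θ' (extendState M (restrictState M S)) := fun S =>
      hrestrict _ _ _ (restrictState_extendState M _).symm
    have h := tendsto_integral_affineState ha σW σb k hK hp τ M
      (g := fun S => Ψ θ' (extendState M S))
      ((hcont θ').comp (continuous_extendState M)) fun S => hB θ' _
    simpa only [← hfac] using h

/-! ### Moments of the limiting Gaussian pairs -/

variable {X : Type*}

/-- Covariance matrix of a Gaussian process at two inputs. -/
def gpMatrix (S : X → X → ℝ) (w : Fin 2 → X) : Matrix (Fin 2) (Fin 2) ℝ :=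
  Matrix.of fun e e' => S (w e) (w e')

lemma gpExpect_eq (S : X → X → ℝ) (g : ℝ → ℝ) (u v : X) :
    gpExpect S g u v = ∫ z, g (z 0) * g (z 1) ∂(multivariateGaussian 0 (gpMatrix S ![u, v])) := by
  have h : !![S u u, S u v; S v u, S v v] = gpMatrix S ![u, v] := by
    ext e e'
    fin_cases e <;> fin_cases e' <;> rfl
  rw [gpExpect, h]

/-- `gpExpect` uses a separate Gaussian for each pair of inputs, repeated inputs included. This
realizes them all as marginals of the single Gaussian at `w`, to which the samples `H` belong. -/
lemma map_multivariateGaussian_pair {S : X → X → ℝ} {w : Fin 2 → X}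
    (hS : (gpMatrix S w).PosSemidef) (e e' : Fin 2) :
    (multivariateGaussian 0 (gpMatrix S w)).map
        (fun z => (WithLp.toLp 2 ![z e, z e'] : EuclideanSpace ℝ (Fin 2)))
      = multivariateGaussian 0 (gpMatrix S ![w e, w e']) := by
  have hsub : gpMatrix S ![w e, w e'] = (gpMatrix S w).submatrix ![e, e'] ![e, e'] := by
    ext b b'
    fin_cases b <;> fin_cases b' <;> rfl
  have hS' : (gpMatrix S ![w e, w e']).PosSemidef := hsub ▸ hS.submatrix _
  have hmeas : Measurable fun z : EuclideanSpace ℝ (Fin 2) =>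
      (WithLp.toLp 2 ![z e, z e'] : EuclideanSpace ℝ (Fin 2)) := by
    refine (WithLp.measurable_toLp 2 _).comp (measurable_pi_lambda _ fun b => ?_)
    fin_cases b <;> simp <;> fun_prop
  have := Measure.isProbabilityMeasure_map (μ := multivariateGaussian 0 (gpMatrix S w))
    hmeas.aemeasurable
  refine Measure.ext_of_charFun (funext fun t => ?_)
  -- The transpose of the coordinate selection `z ↦ (z e, z e')`, applied to `t`.
  let t' : EuclideanSpace ℝ (Fin 2) := WithLp.toLp 2 fun b =>
    (if e = b then t 0 else 0) + if e' = b then t 1 else 0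
  have hinner : ∀ z : EuclideanSpace ℝ (Fin 2),
      inner ℝ (WithLp.toLp 2 ![z e, z e'] : EuclideanSpace ℝ (Fin 2)) t = inner ℝ z t' := by
    intro z
    fin_cases e <;> fin_cases e' <;>
      simp [t', PiLp.inner_apply, Fin.sum_univ_two] <;> ring
  have hquad : t.ofLp ⬝ᵥ (gpMatrix S ![w e, w e']).mulVec t.ofLp
      = t'.ofLp ⬝ᵥ (gpMatrix S w).mulVec t'.ofLp := by
    rw [hsub]
    fin_cases e <;> fin_cases e' <;>
      simp [t', dotProduct, Matrix.mulVec, Fin.sum_univ_two] <;> ring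
  have ht' := charFun_multivariateGaussian (μ := 0) hS t'
  rw [inner_zero_right] at ht'
  rw [charFun_multivariateGaussian hS', hquad, inner_zero_right, ← ht', charFun_apply,
    charFun_apply, integral_map hmeas.aemeasurable (by fun_prop)]
  simp only [hinner]

lemma gpExpect_eq_integral {S : X → X → ℝ} {w : Fin 2 → X} (hS : (gpMatrix S w).PosSemidef)
    {g : ℝ → ℝ} (hg : Continuous g) (e e' : Fin 2) :
    gpExpect S g (w e) (w e') = ∫ z, g (z e) * g (z e') ∂(multivariateGaussian 0 (gpMatrix S w)) := by
  have hmeas : Measurable fun z : EuclideanSpace ℝ (Fin 2) =>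
      (WithLp.toLp 2 ![z e, z e'] : EuclideanSpace ℝ (Fin 2)) := by
    refine (WithLp.measurable_toLp 2 _).comp (measurable_pi_lambda _ fun b => ?_)
    fin_cases b <;> simp <;> fun_prop
  rw [gpExpect_eq, ← map_multivariateGaussian_pair hS,
    integral_map hmeas.aemeasurable (Measurable.aestronglyMeasurable (by fun_prop))]
  simp

lemma ae_tendsto_average {E : Type*} [MeasurableSpace E] (γ : Measure E) [IsProbabilityMeasure γ]
    {f : E → ℝ} (hf : Measurable f) (hint : Integrable f γ) :
    ∀ᵐ H ∂(Measure.infinitePi fun _ : ℕ => γ),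
      Tendsto (fun N : ℕ => (1 / (N : ℝ)) * ∑ j : Fin N, f (H j)) atTop (𝓝 (∫ z, f z ∂γ)) := by
  have hev : ∀ j : ℕ, MeasurePreserving (fun H : ℕ → E => H j) (Measure.infinitePi fun _ => γ) γ :=
    fun j => measurePreserving_eval_infinitePi (fun _ => γ) j
  have hident : ∀ j : ℕ, IdentDistrib (fun H : ℕ → E => f (H j)) (fun H : ℕ → E => f (H 0))
      (Measure.infinitePi fun _ => γ) (Measure.infinitePi fun _ => γ) := fun j =>
    IdentDistrib.comp ⟨(hev j).aemeasurable, (hev 0).aemeasurable,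
      (hev j).map_eq.trans (hev 0).map_eq.symm⟩ hf
  have hind : iIndepFun (fun (j : ℕ) (H : ℕ → E) => f (H j)) (Measure.infinitePi fun _ => γ) :=
    iIndepFun_infinitePi (X := fun _ => f) fun _ => hf
  have hmean : ∫ H, f (H 0) ∂(Measure.infinitePi fun _ : ℕ => γ) = ∫ z, f z ∂γ := by
    conv_rhs => rw [← (hev 0).map_eq]
    rw [integral_map (hev 0).aemeasurable hf.aestronglyMeasurable]
  have h := strong_law_ae_real (fun (j : ℕ) (H : ℕ → E) => f (H j))
    ((hev 0).integrable_comp_of_integrable hint) (fun j j' hjj' => hind.indepFun hjj') hident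
  rw [hmean] at h
  filter_upwards [h] with H hH
  refine hH.congr fun N => ?_
  rw [Finset.sum_range, div_eq_inv_mul, one_div]

/-- A Lipschitz function grows at most linearly, and Gaussian marginals have second moments. -/
lemma memLp_comp_eval_multivariateGaussian {Q : Matrix (Fin 2) (Fin 2) ℝ} (hQ : Q.PosSemidef)
    {φ : ℝ → ℝ} {K : ℝ≥0} (hφ : LipschitzWith K φ) (e : Fin 2) :
    MemLp (fun z : EuclideanSpace ℝ (Fin 2) => φ (z e)) 2 (multivariateGaussian 0 Q) := by
  have h := (memLp_id_gaussianReal' (μ := (0 : EuclideanSpace ℝ (Fin 2)) e)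
    (v := (Q e e).toNNReal) 2 (by simp)).comp_measurePreserving
      (measurePreserving_eval_multivariateGaussian (μ := 0) hQ)
  refine ((h.norm.const_mul (K : ℝ)).add (memLp_const |φ 0|)).mono
    (hφ.continuous.measurable.comp (by fun_prop)).aestronglyMeasurable (.of_forall fun z => ?_)
  have h1 := hφ.dist_le_mul (z e) 0
  rw [Real.dist_eq, dist_zero_right] at h1
  have h2 : |φ (z e)| ≤ |φ (z e) - φ 0| + |φ 0| := by
    simpa using abs_add_le (φ (z e) - φ 0) (φ 0)
  refine le_trans ?_ (le_abs_self _)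
  simp only [Real.norm_eq_abs, Pi.add_apply, Function.comp_apply, id_eq] at h1 ⊢
  linarith

lemma ae_tendsto_gram {S : X → X → ℝ} {w : Fin 2 → X} (hS : (gpMatrix S w).PosSemidef)
    {φ : ℝ → ℝ} {K : ℝ≥0} (hφ : LipschitzWith K φ) :
    ∀ᵐ H ∂(Measure.infinitePi fun _ : ℕ => multivariateGaussian 0 (gpMatrix S w)), ∀ e e',
      Tendsto (fun N : ℕ => (1 / (N : ℝ)) * ∑ j : Fin N, φ (H j e) * φ (H j e')) atTop
        (𝓝 (gpExpect S φ (w e) (w e'))) := by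
  rw [ae_all_iff]
  intro e
  rw [ae_all_iff]
  intro e'
  rw [gpExpect_eq_integral hS hφ.continuous]
  have hc := hφ.continuous.measurable
  exact ae_tendsto_average _ (f := fun z : EuclideanSpace ℝ (Fin 2) => φ (z e) * φ (z e'))
    (by fun_prop) ((memLp_comp_eval_multivariateGaussian hS hφ e).integrable_mul
      (memLp_comp_eval_multivariateGaussian hS hφ e'))

lemma ae_tendsto_average_deriv {S : X → X → ℝ} {w : Fin 2 → X} (hS : (gpMatrix S w).PosSemidef)
    {φ : ℝ → ℝ} (hd : Continuous (deriv φ)) {K : ℝ≥0} (hφ : LipschitzWith K φ) :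
    ∀ᵐ H ∂(Measure.infinitePi fun _ : ℕ => multivariateGaussian 0 (gpMatrix S w)),
      Tendsto (fun N : ℕ => (1 / (N : ℝ)) * ∑ j : Fin N, deriv φ (H j 0) * deriv φ (H j 1)) atTop
        (𝓝 (gpExpect S (deriv φ) (w 0) (w 1))) := by
  rw [gpExpect_eq_integral hS hd]
  have hc := hd.measurable
  have hm : Measurable fun z : EuclideanSpace ℝ (Fin 2) => deriv φ (z 0) * deriv φ (z 1) := by
    fun_prop
  refine ae_tendsto_average _ (f := fun z : EuclideanSpace ℝ (Fin 2) => deriv φ (z 0) * deriv φ (z 1))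
    hm (Integrable.of_bound hm.aestronglyMeasurable (K * K) (.of_forall fun z => ?_))
  rw [norm_mul]
  exact mul_le_mul (norm_deriv_le_of_lipschitz hφ) (norm_deriv_le_of_lipschitz hφ) (norm_nonneg _)
    K.coe_nonneg

lemma posSemidef_gpCov {φ : ℝ → ℝ} {K : ℝ≥0} (hφ : LipschitzWith K φ) (σW σb : ℝ≥0)
    {x : X → (d : ℕ) → Fin d → ℝ} {G : X → X → ℝ}
    (hG : ∀ u v : X,
      Tendsto (fun d : ℕ => (1 / (d : ℝ)) * ∑ j : Fin d, x u d j * x v d j) atTop (𝓝 (G u v)))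
    (w : Fin 2 → X) (k : ℕ) : (gpMatrix (gpCov φ σW σb G k) w).PosSemidef := by
  induction k with
  | zero =>
    exact posSemidef_layerCov (a := fun N j e => x (w e) N j) (fun e e' => hG (w e) (w e')) σW σb
  | succ k ih =>
    -- A single sample at which the strong law holds exhibits the next covariance as a limit of Gram
    -- matrices.
    obtain ⟨H, hH⟩ := (ae_tendsto_gram ih hφ).exists
    exact posSemidef_layerCov (a := fun N j e => φ (H j e)) hH σW σb

/-- The limiting kernel of layer `k` that starts from `κ` times the identity; `τ` is the weight of
the contributions of the parameters. -/
def kernelLimit (φ : ℝ → ℝ) (σW σb : ℝ≥0) (G : X → X → ℝ) (κ τ : ℝ) (u v : X) : ℕ → ℝ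
  | 0 => (σW : ℝ) ^ 2 * κ + τ * (G u v + 1)
  | k + 1 =>
      (σW : ℝ) ^ 2 * (kernelLimit φ σW σb G κ τ u v k * gpExpect (gpCov φ σW σb G k) (deriv φ) u v)
        + τ * (gpExpect (gpCov φ σW σb G k) φ u v + 1)

lemma kernelLimit_zero_one (φ : ℝ → ℝ) (σW σb : ℝ≥0) (G : X → X → ℝ) (u v : X) (k : ℕ) :
    kernelLimit φ σW σb G 0 1 u v k = ntkLimit φ σW σb G k u v := by
  induction k with
  | zero => simp [kernelLimit, ntkLimit]
  | succ k ih => rw [kernelLimit, ih, ntkLimit]; ring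

lemma kernelLimit_one_zero (φ : ℝ → ℝ) (σW σb : ℝ≥0) (G : X → X → ℝ) (u v : X) (k : ℕ) :
    kernelLimit φ σW σb G 1 0 u v k = arkLimit φ σW σb G k u v := by
  induction k with
  | zero => simp [kernelLimit, arkLimit]
  | succ k ih => rw [kernelLimit, ih, arkLimit]; ring

/-! ### Sequential limits -/

/-- The sequential limit evaluates the law only at widths that agree with `n` from index `k` on. -/
lemma SeqLimLaw.congr {M : Type*} [TopologicalSpace M] [MeasurableSpace M] [OpensMeasurableSpace M]
    {F F' : (ℕ → ℕ) → Measure M} {k : ℕ} {n : ℕ → ℕ} {μ : ProbabilityMeasure M}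
    (hF : ∀ m : ℕ → ℕ, (∀ i, k ≤ i → m i = n i) → F m = F' m) (h : SeqLimLaw F k n μ) :
    SeqLimLaw F' k n μ := by
  induction k generalizing n μ with
  | zero => exact (hF n fun _ _ => rfl).symm.trans h
  | succ k ih =>
    obtain ⟨ν, hν, hlim⟩ := h
    refine ⟨ν, fun N hN => ih (fun m hm => hF m fun i hi => ?_) (hν N hN), hlim⟩
    rw [hm i (Nat.le_of_succ_le hi), Function.update_of_ne (by omega)]

/-- The kernel of the first `q` neurons. -/
def readout (q : ℕ) (S : LayerState) : Fin q → Fin q → ℝ := fun i i' => S.2 i i'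

lemma continuous_readout (q : ℕ) : Continuous (readout q) := by
  unfold readout; fun_prop

lemma measurable_readout (q : ℕ) : Measurable (readout q) := by
  unfold readout; fun_prop

lemma measurable_readout_tailState {φ : ℝ → ℝ} (hφ : ContDiff ℝ 1 φ) (c τ : ℝ) (q d k : ℕ)
    (n : ℕ → ℕ) : Measurable fun z : (ParamIdx → ℝ) × (ℕ → EuclideanSpace ℝ (Fin 2)) =>
      readout q (tailState φ τ n z.1 d k (diagState c z.2)) :=
  (measurable_readout q).comp ((measurable_tailState hφ τ n d k).comp
    (measurable_fst.prodMk ((measurable_diagState c).comp measurable_snd)))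

/-- The limiting law of the kernel, when the widths up to that of layer `k` are infinite: the state
of layer `k` consists of independent Gaussian pairs and a multiple of the identity. -/
def partialLimit {φ : ℝ → ℝ} (hφ : ContDiff ℝ 1 φ) (σW σb : ℝ≥0) (c τ : ℝ)
    (Q : Matrix (Fin 2) (Fin 2) ℝ) (q d k : ℕ) (n : ℕ → ℕ) :
    ProbabilityMeasure (Fin q → Fin q → ℝ) :=
  ⟨((initMeasure σW σb).prod (Measure.infinitePi fun _ : ℕ => multivariateGaussian 0 Q)).map
      fun z => readout q (tailState φ τ n z.1 d k (diagState c z.2)),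
    Measure.isProbabilityMeasure_map (measurable_readout_tailState hφ c τ q d k n).aemeasurable⟩

lemma measurable_netState {φ : ℝ → ℝ} (hφ : ContDiff ℝ 1 φ) (κ τ : ℝ) (n : ℕ → ℕ)
    (x : Fin 2 → Fin (n 0) → ℝ) (l : ℕ) : Measurable fun θ => netState φ κ τ n x θ l := by
  induction l with
  | zero => exact measurable_affineState _ _ _ _ _
  | succ l ih => exact (measurable_layerMap hφ τ _ _).comp (measurable_id.prodMk ih)

lemma layerMap_diagState (φ : ℝ → ℝ) (τ : ℝ) (k N : ℕ) (θ : ParamIdx → ℝ) (c : ℝ)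
    (H : ℕ → EuclideanSpace ℝ (Fin 2)) :
    layerMap φ τ k N θ (diagState c H)
      = affineState k N (fun j e => φ (H j e))
          (fun j j' => if j = j' then c * (deriv φ (H j 0) * deriv φ (H j 1)) else 0) τ θ := by
  have h : (fun j j' : Fin N => deriv φ (H j 0) * ((if (j : ℕ) = j' then 1 else 0) * c)
        * deriv φ (H j' 1))
      = fun j j' : Fin N => if j = j' then c * (deriv φ (H j 0) * deriv φ (H j 1)) else 0 := by
    funext j j'
    by_cases hj : j = j'
    · subst hj; simp; ring
    · simp [hj, Fin.val_inj]
  simp only [layerMap, diagState, h]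

lemma integral_partialLimit {φ : ℝ → ℝ} (hφ : ContDiff ℝ 1 φ) (σW σb : ℝ≥0) (c τ : ℝ)
    (Q : Matrix (Fin 2) (Fin 2) ℝ) (q d k : ℕ) (n : ℕ → ℕ)
    (g : BoundedContinuousFunction (Fin q → Fin q → ℝ) ℝ) :
    ∫ y, g y ∂(partialLimit hφ σW σb c τ Q q d k n : Measure (Fin q → Fin q → ℝ))
      = ∫ z, g (readout q (tailState φ τ n z.1 d k (diagState c z.2)))
        ∂((initMeasure σW σb).prod (Measure.infinitePi fun _ : ℕ => multivariateGaussian 0 Q)) :=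
  integral_map (measurable_readout_tailState hφ c τ q d k n).aemeasurable
    g.continuous.aestronglyMeasurable

lemma integrable_partialLimit {φ : ℝ → ℝ} (hφ : ContDiff ℝ 1 φ) (σW σb : ℝ≥0) (c τ : ℝ)
    (Q : Matrix (Fin 2) (Fin 2) ℝ) (q d k : ℕ) (n : ℕ → ℕ)
    (g : BoundedContinuousFunction (Fin q → Fin q → ℝ) ℝ) :
    Integrable (fun z : (ParamIdx → ℝ) × (ℕ → EuclideanSpace ℝ (Fin 2)) =>
        g (readout q (tailState φ τ n z.1 d k (diagState c z.2))))
      ((initMeasure σW σb).prod (Measure.infinitePi fun _ : ℕ => multivariateGaussian 0 Q)) :=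
  Integrable.of_bound (g.continuous.measurable.comp
    (measurable_readout_tailState hφ c τ q d k n)).aestronglyMeasurable ‖g‖
    (.of_forall fun _ => g.norm_coe_le_norm _)

lemma tendsto_integral_readout {φ : ℝ → ℝ} (hφ : ContDiff ℝ 1 φ) (σW σb : ℝ≥0)
    {a : (N : ℕ) → Fin N → Fin 2 → ℝ} {C : Fin 2 → Fin 2 → ℝ}
    (ha : ∀ e e', Tendsto (fun N : ℕ => (1 / (N : ℝ)) * ∑ j : Fin N, a N j e * a N j e') atTop
      (𝓝 (C e e'))) {p : (N : ℕ) → Fin N → ℝ} {K : ℝ} (hK : ∀ N j, |p N j| ≤ K) {π : ℝ}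
    (hp : Tendsto (fun N : ℕ => (1 / (N : ℝ)) * ∑ j : Fin N, p N j) atTop (𝓝 π)) (τ : ℝ)
    {q d k : ℕ} {n : ℕ → ℕ} (hq : n (k + d + 1) = q)
    (g : BoundedContinuousFunction (Fin q → Fin q → ℝ) ℝ) :
    Tendsto (fun N : ℕ => ∫ θ, g (readout q (tailState φ τ n θ d k
        (affineState k N (a N) (fun j j' => if j = j' then p N j else 0) τ θ)))
        ∂(initMeasure σW σb)) atTop
      (𝓝 (∫ y, g y ∂(partialLimit hφ σW σb ((σW : ℝ) ^ 2 * π + τ * (C 0 1 + 1)) τ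
        (layerCov σW σb C) q d k n : Measure (Fin q → Fin q → ℝ)))) := by
  rw [integral_partialLimit, integral_prod _ (integrable_partialLimit hφ σW σb _ τ _ q d k n g)]
  refine tendsto_integral_comp_affineState ha σW σb k hK hp τ (n (k + 1))
    (Ψ := fun θ S => g (readout q (tailState φ τ n θ d k S))) (B := ‖g‖) ?_ ?_ ?_ ?_ ?_
  · exact g.continuous.measurable.comp
      ((measurable_readout q).comp (measurable_tailState hφ τ n d k))
  · exact fun θ => g.continuous.comp
      ((continuous_readout q).comp (continuous_tailState hφ τ n θ d k))
  · exact fun θ S => g.norm_coe_le_norm _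
  · intro θ θ' h
    simp only [tailState_congr_param φ τ n d h]
  · intro θ S S' h
    subst hq
    exact congrArg g (congrArg Prod.snd (restrictState_tailState φ τ n θ d k h))

lemma integral_const_of_isProbabilityMeasure {α : Type*} [MeasurableSpace α] (μ : Measure α)
    [IsProbabilityMeasure μ] (c : ℝ) : ∫ _, c ∂μ = c := by
  simp

/-- Integrate over the parameters first, with the Gaussian pairs `H` fixed. For almost every `H` the
strong laws supply the hypotheses of the one-layer limit, whose value does not depend on `H`. -/
lemma tendsto_partialLimit {φ : ℝ → ℝ} (hφ : ContDiff ℝ 1 φ) {K : ℝ≥0} (hLip : LipschitzWith K φ)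
    (σW σb : ℝ≥0) (c τ : ℝ) {S : X → X → ℝ} {w : Fin 2 → X} (hS : (gpMatrix S w).PosSemidef)
    {q d k : ℕ} {n : ℕ → ℕ} (hq : n (k + 1 + d + 1) = q) :
    Tendsto (fun N => partialLimit hφ σW σb c τ (gpMatrix S w) q (d + 1) k
        (Function.update n (k + 1) N)) atTop
      (𝓝 (partialLimit hφ σW σb ((σW : ℝ) ^ 2 * (c * gpExpect S (deriv φ) (w 0) (w 1))
          + τ * (gpExpect S φ (w 0) (w 1) + 1)) τ
        (layerCov σW σb fun e e' => gpExpect S φ (w e) (w e')) q d (k + 1) n)) := by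
  have hd := hφ.continuous_deriv le_rfl
  refine ProbabilityMeasure.tendsto_iff_forall_integral_tendsto.2 fun g => ?_
  have hstep : ∀ N, ∫ y, g y ∂(partialLimit hφ σW σb c τ (gpMatrix S w) q (d + 1) k
      (Function.update n (k + 1) N) : Measure (Fin q → Fin q → ℝ))
      = ∫ H, ∫ θ, g (readout q (tailState φ τ n θ d (k + 1)
          (affineState (k + 1) N (fun j e => φ (H j e)) (fun j j' => if j = j' then
            c * (deriv φ (H j 0) * deriv φ (H j 1)) else 0) τ θ))) ∂(initMeasure σW σb)
        ∂(Measure.infinitePi fun _ : ℕ => multivariateGaussian 0 (gpMatrix S w)) := fun N => by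
    rw [integral_partialLimit,
      integral_prod_symm _ (integrable_partialLimit hφ σW σb c τ _ q _ k _ g)]
    have h : ∀ θ, tailState φ τ (Function.update n (k + 1) N) θ d (k + 1)
        = tailState φ τ n θ d (k + 1) := fun θ =>
      tailState_congr_width φ τ θ d fun i hi => Function.update_of_ne hi.ne' _ _
    simp only [tailState, h, Function.update_self, layerMap_diagState]
  simp only [hstep]
  -- The limit is written as the integral over `H` of a constant, the form produced by dominated
  -- convergence.
  rw [← integral_const_of_isProbabilityMeasure
    (Measure.infinitePi fun _ : ℕ => multivariateGaussian 0 (gpMatrix S w))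
    (∫ y, g y ∂(partialLimit hφ σW σb _ τ _ q d (k + 1) n : Measure (Fin q → Fin q → ℝ)))]
  refine tendsto_integral_of_dominated_convergence (fun _ => ‖g‖) (fun N => ?_)
    (integrable_const _) (fun N => .of_forall fun H => ?_) ?_
  · have hm : Measurable fun z : (ℕ → EuclideanSpace ℝ (Fin 2)) × (ParamIdx → ℝ) =>
        g (readout q (tailState φ τ n z.2 d (k + 1)
          (layerMap φ τ (k + 1) N z.2 (diagState c z.1)))) :=
      g.continuous.measurable.comp ((measurable_readout q).comp
        ((measurable_tailState hφ τ n d (k + 1)).comp (measurable_snd.prodMk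
          ((measurable_layerMap hφ τ (k + 1) N).comp
            (measurable_snd.prodMk ((measurable_diagState c).comp measurable_fst))))))
    simp only [layerMap_diagState] at hm
    exact (hm.stronglyMeasurable.integral_prod_right'
      (ν := initMeasure σW σb)).aestronglyMeasurable
  · refine (norm_integral_le_of_norm_le_const (.of_forall fun θ => g.norm_coe_le_norm _)).trans ?_
    simp
  · filter_upwards [ae_tendsto_gram hS hLip, ae_tendsto_average_deriv hS hd hLip] with H hH hH'
    refine tendsto_integral_readout hφ σW σb (a := fun N j e => φ (H j e))
      (p := fun N j => c * (deriv φ (H j 0) * deriv φ (H j 1))) (K := |c| * (K * K)) hH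
      (fun N j => ?_) ?_ τ hq g
    · rw [abs_mul, abs_mul]
      exact mul_le_mul_of_nonneg_left (mul_le_mul (norm_deriv_le_of_lipschitz hLip)
        (norm_deriv_le_of_lipschitz hLip) (abs_nonneg _) K.coe_nonneg) (abs_nonneg _)
    · refine (hH'.const_mul c).congr fun N => ?_
      rw [mul_left_comm, Finset.mul_sum]

theorem seqLimLaw_netState {φ : ℝ → ℝ} (hφ : ContDiff ℝ 1 φ) {K : ℝ≥0} (hLip : LipschitzWith K φ)
    (σW σb : ℝ≥0) (κ τ : ℝ) {x : X → (d : ℕ) → Fin d → ℝ} {G : X → X → ℝ}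
    (hG : ∀ u v : X,
      Tendsto (fun d : ℕ => (1 / (d : ℝ)) * ∑ j : Fin d, x u d j * x v d j) atTop (𝓝 (G u v)))
    (w : Fin 2 → X) {q l k d : ℕ} (hl : k + d = l) {n : ℕ → ℕ} (hq : n (l + 1) = q) :
    SeqLimLaw (fun m => (initMeasure σW σb).map fun θ =>
        readout q (netState φ κ τ m (fun e => x (w e) (m 0)) θ l)) (k + 1) n
      (partialLimit hφ σW σb (kernelLimit φ σW σb G κ τ (w 0) (w 1) k) τ
        (gpMatrix (gpCov φ σW σb G k) w) q d k n) := by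
  induction k generalizing d n with
  | zero =>
    have hm : ∀ m : ℕ → ℕ, Measurable fun θ =>
        readout q (netState φ κ τ m (fun e => x (w e) (m 0)) θ l) := fun m =>
      (measurable_readout q).comp (measurable_netState hφ κ τ m _ l)
    refine ⟨fun N => ⟨_, Measure.isProbabilityMeasure_map
      (hm (Function.update n 0 N)).aemeasurable⟩, fun N _ => rfl, ?_⟩
    refine ProbabilityMeasure.tendsto_iff_forall_integral_tendsto.2 fun g => ?_
    have hlim := tendsto_integral_readout hφ σW σb (a := fun N j e => x (w e) N j)
      (C := fun e e' => G (w e) (w e')) (fun e e' => hG (w e) (w e')) (p := fun _ _ => κ)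
      (K := |κ|) (fun _ _ => le_rfl) (π := κ)
      (tendsto_const_nhds.congr' ?_) τ (d := d) (k := 0) (n := n) (by rw [hl, hq]) g
    · refine hlim.congr fun N => ?_
      rw [ProbabilityMeasure.coe_mk, integral_map (hm _).aemeasurable
        g.continuous.aestronglyMeasurable]
      refine integral_congr_ae (.of_forall fun θ => ?_)
      have h0 : netState φ κ τ (Function.update n 0 N)
          (fun e => x (w e) (Function.update n 0 N 0)) θ 0
          = affineState 0 N (fun j e => x (w e) N j) (fun j j' => if j = j' then κ else 0) τ θ :=
        congrArg (fun N => affineState 0 N (fun j e => x (w e) N j)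
          (fun j j' => if j = j' then κ else 0) τ θ) (Function.update_self 0 N n)
      have ht := tailState_netState φ κ τ (Function.update n 0 N)
        (fun e => x (w e) (Function.update n 0 N 0)) θ d 0
      rw [h0, hl, tailState_congr_width φ τ (n' := n) θ d
        fun i hi => Function.update_of_ne hi.ne' _ _] at ht
      exact congrArg (fun S => g (readout q S)) ht
    -- For `N = 0` the average is `0` instead of `κ`, so the equality is only eventual.
    · filter_upwards [eventually_gt_atTop 0] with N hN
      have : (N : ℝ) ≠ 0 := by positivity
      simp [this]
  | succ k ih =>
    -- The inner limits are those of the previous stage, where one more layer, of width `N`, is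
    -- still finite.
    refine ⟨fun N => partialLimit hφ σW σb (kernelLimit φ σW σb G κ τ (w 0) (w 1) k) τ
      (gpMatrix (gpCov φ σW σb G k) w) q (d + 1) k (Function.update n (k + 1) N), fun N _ => ?_, ?_⟩
    · exact ih (by omega) (by rw [Function.update_of_ne (by omega), hq])
    · exact tendsto_partialLimit hφ hLip σW σb _ τ (posSemidef_gpCov hLip σW σb hG w k)
        (by rw [hl, hq])

/-! ### The final point mass and the transfer to an arbitrary probability space -/

lemma partialLimit_zero {φ : ℝ → ℝ} (hφ : ContDiff ℝ 1 φ) (σW σb : ℝ≥0) (c τ : ℝ)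
    (Q : Matrix (Fin 2) (Fin 2) ℝ) (q k : ℕ) (n : ℕ → ℕ) {A : Fin q → Fin q → ℝ}
    (hA : ∀ i i', A i i' = if i = i' then c else 0) :
    partialLimit hφ σW σb c τ Q q 0 k n = diracProba A := by
  have h : (fun z : (ParamIdx → ℝ) × (ℕ → EuclideanSpace ℝ (Fin 2)) =>
      readout q (tailState φ τ n z.1 0 k (diagState c z.2))) = fun _ => A := by
    funext z i i'
    change (if (i : ℕ) = i' then 1 else 0) * c = A i i'
    simp [hA, Fin.val_inj]
  refine Subtype.ext ?_
  change Measure.map _ _ = Measure.dirac _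
  rw [h, Measure.map_const, measure_univ, one_smul]

/-- Countability makes the whole parameter family a measurable random vector. -/
instance : Countable ParamIdx := by
  let f : ParamIdx → (ℕ × ℕ × ℕ) ⊕ (ℕ × ℕ)
    | weight l i j => Sum.inl (l, i, j)
    | bias l i => Sum.inr (l, i)
  refine Function.Injective.countable (f := f) ?_
  rintro (⟨l, i, j⟩ | ⟨l, i⟩) (⟨l', i', j'⟩ | ⟨l', i'⟩) h <;> simp_all [f]

theorem seqLimLaw_of_eq_netState {φ : ℝ → ℝ} (hφ : ContDiff ℝ 1 φ) {K : ℝ≥0}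
    (hLip : LipschitzWith K φ) (σW σb : ℝ≥0) (κ τ : ℝ) {Ω : Type*} [MeasurableSpace Ω]
    (P : Measure Ω) [IsProbabilityMeasure P] {θ : ParamIdx → Ω → ℝ}
    (hlaw : ∀ p, HasLaw (θ p) (initLaw σW σb p) P) (hindep : iIndepFun θ P)
    {x : X → (d : ℕ) → Fin d → ℝ} {G : X → X → ℝ}
    (hG : ∀ u v : X,
      Tendsto (fun d : ℕ => (1 / (d : ℝ)) * ∑ j : Fin d, x u d j * x v d j) atTop (𝓝 (G u v)))
    (u v : X) (l : ℕ) (n : ℕ → ℕ)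
    (T : (m : ℕ → ℕ) → (ParamIdx → ℝ) → Fin (n (l + 1)) → Fin (n (l + 1)) → ℝ)
    (hT : ∀ m : ℕ → ℕ, m (l + 1) = n (l + 1) → ∀ θ, T m θ
      = readout (n (l + 1)) (netState φ κ τ m (fun e => x (![u, v] e) (m 0)) θ l)) :
    SeqLimLaw (fun m => P.map fun ω => T m fun p => θ p ω) (l + 1) n
      (diracProba (X := Fin (n (l + 1)) → Fin (n (l + 1)) → ℝ) (kernelLimit φ σW σb G κ τ u v l •
        (1 : Matrix (Fin (n (l + 1))) (Fin (n (l + 1))) ℝ))) := by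
  have h := seqLimLaw_netState hφ hLip σW σb κ τ hG ![u, v] (k := l) (d := 0) rfl
    (n := n) (q := n (l + 1)) rfl
  rw [partialLimit_zero (A := kernelLimit φ σW σb G κ τ u v l •
    (1 : Matrix (Fin (n (l + 1))) (Fin (n (l + 1))) ℝ)) hφ σW σb _ τ _ _ l n fun i i' => by
      rw [Matrix.smul_apply, Matrix.one_apply, smul_ite, smul_zero, smul_eq_mul, mul_one]
      rfl] at h
  refine h.congr fun m hm => ?_
  have hθ : AEMeasurable (fun ω p => θ p ω) P :=
    aemeasurable_pi_iff.2 fun p => (hlaw p).aemeasurable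
  have hmap : P.map (fun ω p => θ p ω) = initMeasure σW σb :=
    (hindep.hasLaw_infinitePi hlaw hθ).map_eq
  rw [← hmap, AEMeasurable.map_map_of_aemeasurable _ hθ]
  · congr 1
    funext ω
    exact (hT m (hm _ le_rfl) _).symm
  · exact ((measurable_readout _).comp (measurable_netState hφ κ τ m _ l)).aemeasurable

end WideMLP

end

open WideMLP in
theorem theorem1
    -- activation function
    (φ : ℝ → ℝ) (hφ : ContDiff ℝ 1 φ) (hφLip : ∃ K : ℝ≥0, LipschitzWith K φ)
    -- standard deviations of the weights and of the biases at initialization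
    (σW σb : ℝ≥0)
    -- random initialization: independent centered Gaussian parameters
    {Ω : Type*} [MeasurableSpace Ω] (P : Measure Ω) [IsProbabilityMeasure P]
    (θ : ParamIdx → Ω → ℝ)
    (hlaw : ∀ p, HasLaw (θ p) (initLaw σW σb p) P)
    (hindep : iIndepFun θ P)
    -- inputs: the input named `u`, in each input dimension `d`, with limiting Gram kernel `G`
    {X : Type*} (x : X → (d : ℕ) → Fin d → ℝ) (G : X → X → ℝ)
    (hG : ∀ u v : X,
      Tendsto (fun d : ℕ => (1 / (d : ℝ)) * ∑ j : Fin d, x u d j * x v d j) atTop (𝓝 (G u v)))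
    -- number of hidden layers, a layer, and the widths that stay fixed: those from `n (l + 1)` on
    (L l : ℕ) (hl : l ≤ L) (n : ℕ → ℕ) (u v : X) :
    SeqLimLaw
        (fun m => P.map fun ω => fun i i' : Fin (n (l + 1)) =>
          ntk φ L m (fun p => θ p ω) (x u (m 0)) (x v (m 0)) l i i')
        (l + 1) n
        (diracProba (ntkLimit φ σW σb G l u v •
          (1 : Matrix (Fin (n (l + 1))) (Fin (n (l + 1))) ℝ))) ∧
    SeqLimLaw
        (fun m => P.map fun ω => fun i i' : Fin (n (l + 1)) =>
          ark φ m (fun p => θ p ω) (x u (m 0)) (x v (m 0)) l i i')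
        (l + 1) n
        (diracProba (arkLimit φ σW σb G l u v •
          (1 : Matrix (Fin (n (l + 1))) (Fin (n (l + 1))) ℝ))) := by
  obtain ⟨K, hK⟩ := hφLip
  have hd : Differentiable ℝ φ := hφ.differentiable one_ne_zero
  constructor
  · rw [← kernelLimit_zero_one]
    refine seqLimLaw_of_eq_netState hφ hK σW σb 0 1 P hlaw hindep hG u v l n
      (fun m θ i i' => ntk φ L m θ (x u (m 0)) (x v (m 0)) l i i') fun m hm θ => ?_
    funext i i'
    exact ntk_eq_netState hd L m θ (fun e => x (![u, v] e) (m 0)) hl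
      (i.2.trans_eq hm.symm) (i'.2.trans_eq hm.symm)
  · rw [← kernelLimit_one_zero]
    refine seqLimLaw_of_eq_netState hφ hK σW σb 1 0 P hlaw hindep hG u v l n
      (fun m θ i i' => ark φ m θ (x u (m 0)) (x v (m 0)) l i i') fun m _ θ => ?_
    funext i i'
    exact ark_eq_netState hd m θ (fun e => x (![u, v] e) (m 0)) l i i'
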